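/- Let $\mathscr S_2=SL_2(\mathbb R)/SL_2(\mathbb Z)$ be the space of unimodular lattices $L=g\mathbb Z^2$ of $\mathbb R^2$, $\mu_2$ its $SL_2(\mathbb R)$-invariant probability measure, and $\tilde\mu_2$ a probability measure on $\mathscr S_2$ having a bounded density $\sigma\ge 0$ with respect to $\mu_2$. Let $\|\cdot\|$ be the Euclidean norm. For $i\in\{1,2\}$ let $\|L\|_i$ be the least $r>0$ such that the closed ball of radius $r$ centred at $0$ contains $i$ linearly independent vectors of $L$. For $\mu_2$-almost every $L$ one has $\|L\|_1<\|L\|_2$ and there is exactly one pair $(e_1(L),e_2(L))$ of vectors of $L$ with positive first coordinates such that $\|e_1(L)\|=\|L\|_1$ and $\|e_2(L)\|=\|L\|_2$. Let $\Pi$ be the set of coprime pairs $k=(k_1,k_2)\in\mathbb Z^2$ with $k_1\ge 0$, where $k_1=0$ is allowed only for $k=(0,1)$, and let $\Pi_A(L)=\{k\in\Pi:\|k_1e_1(L)+k_2e_2(L)\|\le A\}$. Let $(Z_k)_{k\in\Pi}$ be independent, identically distributed real random variables on a probability space $(\Omega,\mathbb P)$, whose common law is symmetric, has compact support, and is not the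 Dirac mass at $0$. Set $$\tilde S_A(\omega,L)=\sum_{k\in\Pi_A(L)}\frac{Z_k(\omega)}{\|k_1e_1(L)+k_2e_2(L)\|^{3/2}}.$$ Then, as $A\to\infty$, $\tilde S_A$ converges $(\mathbb P\times\tilde\mu_2)$-almost surely to a real random variable $S$ on $\Omega\times\mathscr S_2$, and: 1. $S$ is symmetric ($S$ and $-S$ have the same law), integrable, and $\mathbb E(S)=0$. 2. $\mathbb E(|S|^{1+\kappa})<\infty$ for every $0\le\kappa<\tfrac13$. 3. If there are $m>0$ and $\alpha>0$ such that $\sigma(L)\ge m$ for $\mu_2$-almost every $L$ with $\|L\|_1<\alpha$, then $\mathbb E(|S|^{4/3})=\infty$. 4. If there is $\alpha>0$ with $\tilde\mu_2(\{L\in\mathscr S_2:\|L\|_1<\alpha\})=0$, then $\mathbb E(|S|^p)<\infty$ for every $1\le p<\infty$. -/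

import Mathlib

open MeasureTheory ProbabilityTheory Filter Topology
open scoped NNReal ENNReal

namespace LatticeWeights

/-- The Euclidean plane. -/
abbrev Plane : Type := EuclideanSpace ℝ (Fin 2)

/-- `SL₂(ℤ)` as a subgroup of `SL₂(ℝ)`. -/
def modularSubgroup : Subgroup (Matrix.SpecialLinearGroup (Fin 2) ℝ) :=
  (Matrix.SpecialLinearGroup.map (n := Fin 2) (Int.castRingHom ℝ)).range

/-- The space `𝒮₂ = SL₂(ℝ) / SL₂(ℤ)` of unimodular lattices of the plane; the coset `g SL₂(ℤ)`
stands for the lattice `g ℤ²`. -/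
def UnimodularLattice : Type :=
  Matrix.SpecialLinearGroup (Fin 2) ℝ ⧸ modularSubgroup

namespace UnimodularLattice

/-- The quotient topology. -/
instance : TopologicalSpace UnimodularLattice :=
  inferInstanceAs
    (TopologicalSpace (Matrix.SpecialLinearGroup (Fin 2) ℝ ⧸ modularSubgroup))

/-- The action of `SL₂(ℝ)` by left translations, that is `(h, L) ↦ h L`. -/
instance : MulAction (Matrix.SpecialLinearGroup (Fin 2) ℝ) UnimodularLattice :=
  inferInstanceAs (MulAction (Matrix.SpecialLinearGroup (Fin 2) ℝ)
    (Matrix.SpecialLinearGroup (Fin 2) ℝ ⧸ modularSubgroup))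

/-- The Borel σ-algebra. -/
instance : MeasurableSpace UnimodularLattice := borel UnimodularLattice

instance : BorelSpace UnimodularLattice := ⟨rfl⟩

end UnimodularLattice

/-- The subgroup `g ℤ²` of the plane, for `g ∈ SL₂(ℝ)`. -/
def matrixLattice (g : Matrix.SpecialLinearGroup (Fin 2) ℝ) : AddSubgroup Plane where
  carrier := {v | ∃ n : Fin 2 → ℤ, v = WithLp.toLp 2 (g.1.mulVec fun i => (n i : ℝ))}
  zero_mem' := ⟨0, by ext i; simp [Matrix.mulVec, dotProduct]⟩
  add_mem' := by
    rintro _ _ ⟨n, rfl⟩ ⟨m, rfl⟩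
    refine ⟨n + m, ?_⟩
    ext i
    simp only [Matrix.mulVec, dotProduct, Fin.sum_univ_two, Pi.add_apply, Pi.neg_apply,
      PiLp.add_apply, PiLp.neg_apply, Int.cast_add, Int.cast_neg]
    ring
  neg_mem' := by
    rintro _ ⟨n, rfl⟩
    refine ⟨-n, ?_⟩
    ext i
    simp only [Matrix.mulVec, dotProduct, Fin.sum_univ_two, Pi.add_apply, Pi.neg_apply,
      PiLp.add_apply, PiLp.neg_apply, Int.cast_add, Int.cast_neg]
    ring

theorem matrixLattice_mul_le (g : Matrix.SpecialLinearGroup (Fin 2) ℝ)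
    (γ : Matrix.SpecialLinearGroup (Fin 2) ℤ) :
    matrixLattice (g * Matrix.SpecialLinearGroup.map (Int.castRingHom ℝ) γ) ≤
      matrixLattice g := by
  rintro _ ⟨n, rfl⟩
  refine ⟨γ.1.mulVec n, ?_⟩
  ext i
  simp [Matrix.mulVec, dotProduct, Matrix.mul_apply, Fin.sum_univ_two]
  ring

theorem matrixLattice_mul (g : Matrix.SpecialLinearGroup (Fin 2) ℝ)
    (γ : Matrix.SpecialLinearGroup (Fin 2) ℤ) :
    matrixLattice (g * Matrix.SpecialLinearGroup.map (Int.castRingHom ℝ) γ) =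
      matrixLattice g := by
  refine le_antisymm (matrixLattice_mul_le g γ) ?_
  have h := matrixLattice_mul_le
    (g * Matrix.SpecialLinearGroup.map (Int.castRingHom ℝ) γ) γ⁻¹
  simpa [mul_assoc, ← map_mul] using h

/-- The lattice of the plane, as a set of vectors, represented by a point of `𝒮₂`. -/
def UnimodularLattice.vectors (L : UnimodularLattice) : AddSubgroup Plane :=
  Quotient.liftOn' L matrixLattice (by
    intro a b h
    rw [QuotientGroup.leftRel_apply] at h
    obtain ⟨γ, hγ⟩ := h
    have hb : b = a * Matrix.SpecialLinearGroup.map (Int.castRingHom ℝ) γ := by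
      rw [hγ]; group
    rw [hb, matrixLattice_mul])

/-- The `i`-th successive minimum `‖L‖ᵢ`: the least `r > 0` such that the closed ball of radius
`r` around `0` contains `i` linearly independent vectors of `L`. -/
noncomputable def succMin (i : ℕ) (L : UnimodularLattice) : ℝ :=
  sInf {r : ℝ | 0 < r ∧ ∃ v : Fin i → Plane,
    (∀ j, v j ∈ L.vectors ∧ ‖v j‖ ≤ r) ∧ LinearIndependent ℝ v}

/-- `(v₁, v₂)` is a pair of vectors of `L`, with positive first coordinates, that realize the
two successive minima of `L`. -/
def IsMinimalPair (L : UnimodularLattice) (v : Plane × Plane) : Prop :=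
  (v.1 ∈ L.vectors ∧ 0 < v.1 0 ∧ ‖v.1‖ = succMin 1 L) ∧
  (v.2 ∈ L.vectors ∧ 0 < v.2 0 ∧ ‖v.2‖ = succMin 2 L)

open Classical in
/-- The pair `(e₁(L), e₂(L))`, when there is exactly one minimal pair. This is so for almost
every `L`; the value `(0, 0)` elsewhere is arbitrary. -/
noncomputable def minimalPair (L : UnimodularLattice) : Plane × Plane :=
  if h : ∃! v, IsMinimalPair L v then h.choose else 0

/-- The index set `Π`: coprime pairs `(k₁, k₂)` with `k₁ ≥ 0`, where for `k₁ = 0` only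
`(0, 1)` is kept. -/
def PrimeIndex : Type :=
  {k : ℤ × ℤ // Int.gcd k.1 k.2 = 1 ∧ 0 ≤ k.1 ∧ (k.1 = 0 → k.2 = 1)}

/-- The norm `‖k₁ e₁(L) + k₂ e₂(L)‖`. -/
noncomputable def indexNorm (L : UnimodularLattice) (k : PrimeIndex) : ℝ :=
  ‖k.1.1 • (minimalPair L).1 + k.1.2 • (minimalPair L).2‖

/-- The index set `Π_A(L)`. -/
def primeIndexUpTo (A : ℝ) (L : UnimodularLattice) : Set PrimeIndex :=
  {k | indexNorm L k ≤ A}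

/-- The modified Siegel transform
`S̃_A(ω, L) = ∑_{k ∈ Π_A(L)} Z_k(ω) / ‖k₁ e₁(L) + k₂ e₂(L)‖^{3/2}`
(a finite sum whenever `e₁(L), e₂(L)` are linearly independent). -/
noncomputable def modifiedSiegel {Ω : Type*} (Z : PrimeIndex → Ω → ℝ) (A : ℝ)
    (x : Ω × UnimodularLattice) : ℝ :=
  ∑ᶠ k ∈ primeIndexUpTo A x.2, Z k x.1 / indexNorm x.2 k ^ (3 / 2 : ℝ)

end LatticeWeights

/-! For a fixed lattice `L`, the sum is a series of independent, centred, bounded variables, with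
coefficients the norms of `k₁e₁ + k₂e₂` to the power `-3/2`. The vectors `e₁, e₂` are nearly
orthogonal, so these norms are at least `‖L‖₁ |k| / 2` (`IsGeneric.le_indexNorm`). As `∑ |k|⁻³` over
`ℤ²` converges, the squared coefficients sum to at most a constant times `‖L‖₁⁻³`. Martingale
convergence gives the limit `S`, and subgaussian bounds with Fatou give `E(|S|^p | L) ≤ C
‖L‖₁^(-3p/2)` (`exists_lintegral_limitSum_rpow_le`).

This order is sharp. Flipping the signs of all weights but that of `(1, 0)` preserves the law, and
the two sums add up to `2 Z ‖L‖₁^(-3/2)` with `Z` the weight of `(1, 0)`; hence `E(|S|^p | L) ≥ c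
‖L‖₁^(-3p/2)` (`lintegral_first_rpow_mul_le`). Flipping every sign shows that `S` is symmetric.

Everything is thus reduced to the integrability of `‖L‖₁^(-s)`, `s = 3p/2`. Under `μ₂` it is
integrable for `0 ≤ s < 2` but not, even on the cusp alone, for `s = 2`, that is `p = 4/3`. This
rests on `μ₂(‖L‖₁ < r) ≍ r²` along `r = 2⁻ⁿ`. Siegel's mean value formula is avoided: the mean
number of visible vectors in a triangle with apex `0` is multiplied by `4` when the triangle is
doubled, because a diagonal matrix and four shears carry the large triangle to copies of the small
one (`visMean_sector_two_mul`). Small triangles contain at most one visible vector, so these means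
compare with measures of cusp neighbourhoods.

Almost every lattice is generic by invariance under shears and Fubini: each lattice has only
countably many nongeneric shears (`ae_isGeneric`). -/

namespace LatticeWeights

/-! ### Linear action on the plane and Borel structure of the space of lattices -/

/-- The group `SL₂(ℝ)`. -/
abbrev SLTwo : Type := Matrix.SpecialLinearGroup (Fin 2) ℝ

/-- The linear action of `SL₂(ℝ)` on the plane. -/
noncomputable def act (g : SLTwo) (v : Plane) : Plane := WithLp.toLp 2 (g.1.mulVec v.ofLp)

/-- An integer vector, seen in the plane. -/
noncomputable def intVec (n : Fin 2 → ℤ) : Plane := WithLp.toLp 2 fun i => (n i : ℝ)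

@[simp] theorem intVec_apply (n : Fin 2 → ℤ) (i : Fin 2) : intVec n i = n i := rfl

theorem act_apply_zero (g : SLTwo) (v : Plane) : act g v 0 = g.1 0 0 * v 0 + g.1 0 1 * v 1 := by
  simp [act]

theorem act_apply_one (g : SLTwo) (v : Plane) : act g v 1 = g.1 1 0 * v 0 + g.1 1 1 * v 1 := by
  simp [act]

theorem plane_ext {v w : Plane} (h0 : v 0 = w 0) (h1 : v 1 = w 1) : v = w := by
  ext i; fin_cases i <;> assumption

theorem act_mul (g h : SLTwo) (v : Plane) : act (g * h) v = act g (act h v) := by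
  apply plane_ext <;>
  · simp only [act_apply_zero, act_apply_one, Matrix.SpecialLinearGroup.coe_mul, Matrix.mul_apply,
      Fin.sum_univ_two]
    ring

@[simp] theorem act_one (v : Plane) : act 1 v = v := by
  simp [act]

@[simp] theorem act_inv_act (g : SLTwo) (v : Plane) : act g⁻¹ (act g v) = v := by
  rw [← act_mul, inv_mul_cancel, act_one]

@[simp] theorem act_act_inv (g : SLTwo) (v : Plane) : act g (act g⁻¹ v) = v := by
  rw [← act_mul, mul_inv_cancel, act_one]

theorem act_injective (g : SLTwo) : Function.Injective (act g) :=
  Function.LeftInverse.injective (act_inv_act g)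

theorem act_smul (g : SLTwo) (t : ℝ) (v : Plane) : act g (t • v) = t • act g v := by
  apply plane_ext <;>
  · simp only [act_apply_zero, act_apply_one, PiLp.smul_apply, smul_eq_mul]
    ring

@[simp] theorem act_zero (g : SLTwo) : act g 0 = 0 := by
  simp [act]

theorem intVec_injective : Function.Injective intVec := by
  intro n m h
  ext i
  have := congrArg (fun v : Plane => v i) h
  simpa using this

theorem continuous_act : Continuous fun p : SLTwo × Plane => act p.1 p.2 := by
  unfold act
  refine (PiLp.continuous_toLp 2 _).comp ?_
  refine Continuous.matrix_mulVec ?_ ?_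
  · exact continuous_subtype_val.comp continuous_fst
  · exact (PiLp.continuous_ofLp 2 _).comp continuous_snd

/-- The determinant of two vectors of the plane. -/
def planeDet (v w : Plane) : ℝ := v 0 * w 1 - v 1 * w 0

theorem planeDet_act (g : SLTwo) (v w : Plane) : planeDet (act g v) (act g w) = planeDet v w := by
  have h := g.2
  rw [Matrix.det_fin_two] at h
  simp only [planeDet, act_apply_zero, act_apply_one]
  linear_combination (v 0 * w 1 - v 1 * w 0) * h

theorem norm_sq_plane (v : Plane) : ‖v‖ ^ 2 = v 0 ^ 2 + v 1 ^ 2 := by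
  rw [EuclideanSpace.norm_sq_eq, Fin.sum_univ_two]; simp

namespace UnimodularLattice

/-- The lattice `g ℤ²`. -/
def mk (g : SLTwo) : UnimodularLattice := (QuotientGroup.mk g : SLTwo ⧸ modularSubgroup)

theorem mk_surjective : Function.Surjective mk := QuotientGroup.mk_surjective

theorem continuous_mk : Continuous mk := QuotientGroup.continuous_mk

theorem smul_mk (h g : SLTwo) : h • mk g = mk (h * g) := rfl

theorem mem_vectors_mk {g : SLTwo} {v : Plane} :
    v ∈ (mk g).vectors ↔ ∃ n, v = act g (intVec n) := Iff.rfl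

theorem act_intVec_mem (g : SLTwo) (n : Fin 2 → ℤ) : act g (intVec n) ∈ (mk g).vectors := ⟨n, rfl⟩

theorem mem_vectors_smul {h : SLTwo} {L : UnimodularLattice} {v : Plane} :
    v ∈ (h • L).vectors ↔ act h⁻¹ v ∈ L.vectors := by
  obtain ⟨g, rfl⟩ := mk_surjective L
  rw [smul_mk, mem_vectors_mk, mem_vectors_mk]
  refine exists_congr fun n => ?_
  rw [act_mul]
  constructor
  · rintro rfl; simp
  · intro e; rw [← e]; simp

theorem countable_vectors (L : UnimodularLattice) : (L.vectors : Set Plane).Countable := by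
  obtain ⟨g, rfl⟩ := mk_surjective L
  refine (Set.countable_range fun n => act g (intVec n)).mono ?_
  rintro v ⟨n, rfl⟩
  exact ⟨n, rfl⟩

/-- Integrality of the entries is a closed condition. Closedness makes the quotient T1, a separation
property that the comparison of Borel structures below relies on. -/
theorem isClosed_modularSubgroup : IsClosed (modularSubgroup : Set SLTwo) := by
  have : (modularSubgroup : Set SLTwo) =
      ⋂ i, ⋂ j, (fun g : SLTwo => g.1 i j) ⁻¹' (Set.range ((↑) : ℤ → ℝ)) := by
    ext g
    simp only [Set.mem_iInter, Set.mem_preimage, Set.mem_range]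
    constructor
    · rintro ⟨γ, rfl⟩ i j
      exact ⟨γ.1 i j, rfl⟩
    · intro h
      choose γ hγ using h
      have hd : Matrix.det (Matrix.of γ) = 1 := by
        have h := g.2
        rw [Matrix.det_fin_two] at h ⊢
        simp only [← hγ] at h
        simp only [Matrix.of_apply]
        exact_mod_cast h
      refine ⟨⟨Matrix.of γ, hd⟩, ?_⟩
      ext i j
      exact hγ i j
  rw [this]
  refine isClosed_iInter fun i => isClosed_iInter fun j => ?_
  refine Int.isClosedEmbedding_coe_real.isClosed_range.preimage ?_
  exact (continuous_apply_apply i j).comp continuous_subtype_val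

instance : T1Space UnimodularLattice :=
  QuotientGroup.t1Space_iff.mpr isClosed_modularSubgroup

instance : PolishSpace (Matrix (Fin 2) (Fin 2) ℝ) :=
  inferInstanceAs (PolishSpace (Fin 2 → Fin 2 → ℝ))

instance : SecondCountableTopology SLTwo :=
  TopologicalSpace.Subtype.secondCountableTopology
    {A : Matrix (Fin 2) (Fin 2) ℝ | A.det = 1}

instance : SecondCountableTopology UnimodularLattice :=
  inferInstanceAs (SecondCountableTopology (SLTwo ⧸ modularSubgroup))

instance : ContinuousSMul SLTwo UnimodularLattice :=
  inferInstanceAs (ContinuousSMul SLTwo (SLTwo ⧸ modularSubgroup))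

instance : PolishSpace SLTwo := by
  have : IsClosed {A : Matrix (Fin 2) (Fin 2) ℝ | A.det = 1} :=
    isClosed_eq (Continuous.matrix_det continuous_id) continuous_const
  exact this.polishSpace

instance : MeasurableSpace SLTwo := borel SLTwo

instance : BorelSpace SLTwo := ⟨rfl⟩

/-- A continuous surjection from a Polish space onto a second countable T0 space induces exactly the
Borel σ-algebra. Measurability can therefore be tested on matrices, where lattice vectors are
indexed by the countable set of integer vectors. -/
theorem measurableSet_preimage_mk_iff {s : Set UnimodularLattice} :
    MeasurableSet (mk ⁻¹' s) ↔ MeasurableSet s := by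
  have h := continuous_mk.map_borel_eq mk_surjective
  exact iff_of_eq (congrArg (fun m : MeasurableSpace UnimodularLattice => MeasurableSet[m] s) h)

theorem measurable_comp_mk_iff {β : Type*} [MeasurableSpace β] {f : UnimodularLattice → β} :
    Measurable (f ∘ mk) ↔ Measurable f := by
  constructor
  · intro h s hs
    exact measurableSet_preimage_mk_iff.1 (h hs)
  · intro h
    exact h.comp continuous_mk.measurable

theorem measurable_act_intVec (n : Fin 2 → ℤ) : Measurable fun g : SLTwo => act g (intVec n) :=
  (continuous_act.comp (Continuous.prodMk_left (intVec n))).measurable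

end UnimodularLattice

end LatticeWeights

/-! ### Successive minima and reduced bases -/

namespace LatticeWeights

open UnimodularLattice

/-- Applying `g⁻¹` bounds the integer coordinates by the entries of `g⁻¹` times `R`. -/
theorem finite_intVec_norm_le (g : SLTwo) (R : ℝ) :
    {n : Fin 2 → ℤ | ‖act g (intVec n)‖ ≤ R}.Finite := by
  have key : ∀ v : Plane, ‖act g v‖ ≤ R → ∀ i, |v i| ≤
      (|g⁻¹.1 0 0| + |g⁻¹.1 0 1| + |g⁻¹.1 1 0| + |g⁻¹.1 1 1|) * R := by
    intro v hv i
    set w := act g v with hw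
    have e : v = act g⁻¹ w := by simp [hw]
    have h0 : |w 0| ≤ R := (PiLp.norm_apply_le w 0).trans hv
    have h1 : |w 1| ≤ R := (PiLp.norm_apply_le w 1).trans hv
    have hR : 0 ≤ R := (abs_nonneg _).trans h0
    have a0 := mul_nonneg (abs_nonneg (g⁻¹.1 0 0)) hR
    have a1 := mul_nonneg (abs_nonneg (g⁻¹.1 0 1)) hR
    have a2 := mul_nonneg (abs_nonneg (g⁻¹.1 1 0)) hR
    have a3 := mul_nonneg (abs_nonneg (g⁻¹.1 1 1)) hR
    have gen : ∀ a b : ℝ, |a * w 0 + b * w 1| ≤ |a| * R + |b| * R := by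
      intro a b
      refine (abs_add_le _ _).trans ?_
      rw [abs_mul, abs_mul]
      gcongr
    rw [e]
    fin_cases i
    · simp only [Fin.zero_eta, act_apply_zero]
      linarith [gen (g⁻¹.1 0 0) (g⁻¹.1 0 1)]
    · simp only [Fin.mk_one, act_apply_one]
      linarith [gen (g⁻¹.1 1 0) (g⁻¹.1 1 1)]
  set M : ℝ := (|g⁻¹.1 0 0| + |g⁻¹.1 0 1| + |g⁻¹.1 1 0| + |g⁻¹.1 1 1|) * R
  refine (Set.finite_Icc (fun _ : Fin 2 => -⌈M⌉) (fun _ => ⌈M⌉)).subset ?_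
  intro n hn
  have h := fun i => abs_le.1 ((key (intVec n) hn i).trans (Int.le_ceil M))
  simp only [intVec_apply] at h
  refine ⟨fun i => ?_, fun i => ?_⟩
  · exact_mod_cast (h i).1
  · exact_mod_cast (h i).2

theorem finite_vectors_norm_le (L : UnimodularLattice) (R : ℝ) :
    {v | v ∈ L.vectors ∧ ‖v‖ ≤ R}.Finite := by
  obtain ⟨g, rfl⟩ := mk_surjective L
  refine ((finite_intVec_norm_le g R).image fun n => act g (intVec n)).subset ?_
  rintro v ⟨⟨n, rfl⟩, hv⟩
  exact ⟨n, hv, rfl⟩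

theorem exists_norm_minimal {L : UnimodularLattice} {S : Set Plane}
    (hS : ∀ v ∈ S, v ∈ L.vectors) (hne : S.Nonempty) : ∃ v ∈ S, ∀ w ∈ S, ‖v‖ ≤ ‖w‖ := by
  obtain ⟨x, hx⟩ := hne
  have hfin : {v | v ∈ S ∧ ‖v‖ ≤ ‖x‖}.Finite :=
    (finite_vectors_norm_le L ‖x‖).subset fun v hv => ⟨hS v hv.1, hv.2⟩
  obtain ⟨v, hv, hmin⟩ := Set.exists_min_image _ (fun v : Plane => ‖v‖) hfin ⟨x, hx, le_rfl⟩
  refine ⟨v, hv.1, fun w hw => ?_⟩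
  by_cases h : ‖w‖ ≤ ‖x‖
  · exact hmin w ⟨hw, h⟩
  · exact hv.2.trans (not_le.1 h).le

theorem planeDet_smul_add (u w : Plane) (s t : ℝ) :
    planeDet u (s • u + t • w) = t * planeDet u w := by
  simp [planeDet]; ring

theorem planeDet_swap (v w : Plane) : planeDet w v = -planeDet v w := by
  simp [planeDet]; ring

@[simp] theorem planeDet_zero_left (v : Plane) : planeDet 0 v = 0 := by
  simp [planeDet]

@[simp] theorem planeDet_zero_right (v : Plane) : planeDet v 0 = 0 := by
  simp [planeDet]

theorem planeDet_neg_right (v w : Plane) : planeDet v (-w) = -planeDet v w := by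
  simp [planeDet]; ring

theorem planeDet_neg_left (v w : Plane) : planeDet (-v) w = -planeDet v w := by
  simp [planeDet]; ring

theorem linearIndependent_iff_planeDet (v : Fin 2 → Plane) :
    LinearIndependent ℝ v ↔ planeDet (v 0) (v 1) ≠ 0 := by
  have e : v = ![v 0, v 1] := by ext i; fin_cases i <;> rfl
  rw [e, LinearIndependent.pair_iff]
  simp only [Matrix.cons_val_zero, Matrix.cons_val_one]
  constructor
  · intro h hd
    -- If the determinant vanishes, the coordinates of the two vectors are coefficients of linear
    -- relations between them; independence makes all coordinates zero.
    have h1 := h (v 1 1) (-(v 0 1)) (by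
      apply plane_ext
      · simp only [planeDet] at hd; simp; linarith
      · simp; ring)
    have h2 := h (v 1 0) (-(v 0 0)) (by
      apply plane_ext
      · simp; ring
      · simp only [planeDet] at hd; simp; linarith)
    have h3 := h 1 0 (by
      apply plane_ext
      · simp; linarith [h2.2]
      · simp; linarith [h1.2])
    exact one_ne_zero h3.1
  · intro hd s t h
    constructor
    · have := congrArg (planeDet (v 1)) h
      rw [add_comm, planeDet_smul_add, planeDet_swap (v 0)] at this
      simpa [hd] using this
    · have := congrArg (planeDet (v 0)) h
      rw [planeDet_smul_add] at this
      simpa [hd] using this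

theorem exists_planeDet_ne_zero (L : UnimodularLattice) {u : Plane} (hu : u ≠ 0) :
    ∃ v ∈ L.vectors, planeDet u v ≠ 0 := by
  obtain ⟨g, rfl⟩ := mk_surjective L
  by_contra! h
  apply hu
  have key : ∀ n, planeDet (act g⁻¹ u) (intVec n) = 0 := by
    intro n
    rw [← planeDet_act g, act_act_inv]
    exact h _ (act_intVec_mem g n)
  have h0 := key ![1, 0]
  have h1 := key ![0, 1]
  simp [planeDet] at h0 h1
  have : act g⁻¹ u = 0 := plane_ext h1 h0
  rw [← act_act_inv g u, this, act_zero]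

/-- A shortest nonzero vector together with a shortest vector off the line it spans. -/
theorem exists_reduced_pair (L : UnimodularLattice) :
    ∃ u ∈ L.vectors, ∃ v ∈ L.vectors, u ≠ 0 ∧ planeDet u v ≠ 0 ∧
      (∀ w ∈ L.vectors, w ≠ 0 → ‖u‖ ≤ ‖w‖) ∧
      (∀ w ∈ L.vectors, planeDet u w ≠ 0 → ‖v‖ ≤ ‖w‖) := by
  obtain ⟨x, hx, hx0⟩ : ∃ x ∈ L.vectors, x ≠ 0 := by
    obtain ⟨x, hx, h⟩ := exists_planeDet_ne_zero L
      (u := intVec ![1, 0]) (by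
        intro h
        simpa using congrArg (fun v : Plane => v 0) h)
    refine ⟨x, hx, ?_⟩
    rintro rfl
    simp at h
  obtain ⟨u, ⟨hu, hu0⟩, humin⟩ := exists_norm_minimal (L := L)
    (S := {w | w ∈ L.vectors ∧ w ≠ 0}) (fun v hv => hv.1) ⟨x, hx, hx0⟩
  obtain ⟨y, hy, hy0⟩ := exists_planeDet_ne_zero L hu0
  obtain ⟨v, ⟨hv, hv0⟩, hvmin⟩ := exists_norm_minimal (L := L)
    (S := {w | w ∈ L.vectors ∧ planeDet u w ≠ 0}) (fun v hv => hv.1) ⟨y, hy, hy0⟩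
  exact ⟨u, hu, v, hv, hu0, hv0, fun w hw h => humin w ⟨hw, h⟩, fun w hw h => hvmin w ⟨hw, h⟩⟩

theorem succMin_one_eq {L : UnimodularLattice} {u : Plane} (hu : u ∈ L.vectors) (hu0 : u ≠ 0)
    (hmin : ∀ w ∈ L.vectors, w ≠ 0 → ‖u‖ ≤ ‖w‖) : succMin 1 L = ‖u‖ := by
  refine IsLeast.csInf_eq ⟨⟨norm_pos_iff.2 hu0, fun _ => u, fun _ => ⟨hu, le_rfl⟩, ?_⟩, ?_⟩
  · exact linearIndependent_unique_iff.2 hu0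
  · rintro r ⟨_, v, hv, hli⟩
    exact (hmin _ (hv 0).1 (hli.ne_zero 0)).trans (hv 0).2

/-- Two independent vectors cannot both lie on the line of `u`, so any competing pair contains a
vector at least as long as `v`. -/
theorem succMin_two_eq {L : UnimodularLattice} {u v : Plane} (hu : u ∈ L.vectors)
    (hv : v ∈ L.vectors) (hu0 : u ≠ 0) (huv : planeDet u v ≠ 0)
    (humin : ∀ w ∈ L.vectors, w ≠ 0 → ‖u‖ ≤ ‖w‖)
    (hvmin : ∀ w ∈ L.vectors, planeDet u w ≠ 0 → ‖v‖ ≤ ‖w‖) : succMin 2 L = ‖v‖ := by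
  have hv0 : v ≠ 0 := by rintro rfl; simp at huv
  refine IsLeast.csInf_eq ⟨⟨norm_pos_iff.2 hv0, ![u, v], ?_, ?_⟩, ?_⟩
  · intro j
    fin_cases j
    · exact ⟨hu, humin v hv hv0⟩
    · exact ⟨hv, le_rfl⟩
  · rw [linearIndependent_iff_planeDet]
    exact huv
  · rintro r ⟨_, w, hw, hli⟩
    rw [linearIndependent_iff_planeDet] at hli
    by_cases h0 : planeDet u (w 0) = 0
    · by_cases h1 : planeDet u (w 1) = 0
      · exfalso
        have hz : ∀ a b c d x y : ℝ, x * b - y * a = 0 → x * d - y * c = 0 → (x ≠ 0 ∨ y ≠ 0) →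
            a * d - b * c = 0 := by
          intro a b c d x y e1 e2 hxy
          rcases hxy with hx | hy
          · apply mul_left_cancel₀ hx; linear_combination a * e2 - c * e1
          · apply mul_left_cancel₀ hy; linear_combination b * e2 - d * e1
        refine hli (hz _ _ _ _ (u 0) (u 1) h0 h1 ?_)
        by_contra! h
        exact hu0 (plane_ext h.1 h.2)
      · exact (hvmin _ (hw 1).1 h1).trans (hw 1).2
    · exact (hvmin _ (hw 0).1 h0).trans (hw 0).2

/-- A pair realizing the successive minima. -/
theorem exists_pair_succMin (L : UnimodularLattice) :
    ∃ u ∈ L.vectors, ∃ v ∈ L.vectors, u ≠ 0 ∧ planeDet u v ≠ 0 ∧ ‖u‖ = succMin 1 L ∧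
      ‖v‖ = succMin 2 L := by
  obtain ⟨u, hu, v, hv, hu0, huv, humin, hvmin⟩ := exists_reduced_pair L
  exact ⟨u, hu, v, hv, hu0, huv, (succMin_one_eq hu hu0 humin).symm,
    (succMin_two_eq hu hv hu0 huv humin hvmin).symm⟩

theorem succMin_one_le {L : UnimodularLattice} {w : Plane} (hw : w ∈ L.vectors) (hw0 : w ≠ 0) :
    succMin 1 L ≤ ‖w‖ := by
  obtain ⟨u, hu, v, hv, hu0, huv, humin, hvmin⟩ := exists_reduced_pair L
  rw [succMin_one_eq hu hu0 humin]
  exact humin w hw hw0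

theorem succMin_one_pos (L : UnimodularLattice) : 0 < succMin 1 L := by
  obtain ⟨u, hu, v, hv, hu0, huv, h1, h2⟩ := exists_pair_succMin L
  rw [← h1]
  exact norm_pos_iff.2 hu0

theorem succMin_two_le {L : UnimodularLattice} {v w : Plane} (hv : v ∈ L.vectors)
    (hw : w ∈ L.vectors) (h : planeDet v w ≠ 0) : succMin 2 L ≤ max ‖v‖ ‖w‖ := by
  have hv0 : v ≠ 0 := by rintro rfl; simp at h
  refine csInf_le ⟨0, fun r hr => hr.1.le⟩ ⟨lt_max_of_lt_left (norm_pos_iff.2 hv0), ![v, w], ?_, ?_⟩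
  · intro j
    fin_cases j
    · exact ⟨hv, le_max_left _ _⟩
    · exact ⟨hw, le_max_right _ _⟩
  · rw [linearIndependent_iff_planeDet]
    exact h

theorem succMin_one_le_two (L : UnimodularLattice) : succMin 1 L ≤ succMin 2 L := by
  obtain ⟨u, hu, v, hv, hu0, huv, h1, h2⟩ := exists_pair_succMin L
  rw [← h2]
  refine succMin_one_le hv ?_
  rintro rfl
  simp at huv

/-- A lattice without nonzero vertical vectors, in which vectors of the same norm are equal up to
sign. -/
def IsGeneric (L : UnimodularLattice) : Prop :=
  (∀ v ∈ L.vectors, v ≠ 0 → v 0 ≠ 0) ∧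
    ∀ v ∈ L.vectors, ∀ w ∈ L.vectors, ‖v‖ = ‖w‖ → v = w ∨ v = -w

theorem IsGeneric.exists_pos_of_norm {L : UnimodularLattice} (hL : IsGeneric L) {u : Plane}
    (hu : u ∈ L.vectors) (hu0 : u ≠ 0) : ∃ u', u' ∈ L.vectors ∧ (u' = u ∨ u' = -u) ∧ 0 < u' 0 ∧
      ∀ w ∈ L.vectors, 0 < w 0 → ‖w‖ = ‖u‖ → w = u' := by
  rcases lt_or_gt_of_ne (hL.1 u hu hu0) with h | h
  · refine ⟨-u, neg_mem hu, Or.inr rfl, by simpa using h, fun w hw hw0 e => ?_⟩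
    rcases hL.2 w hw u hu e with rfl | rfl
    · exact absurd hw0 h.not_gt
    · rfl
  · refine ⟨u, hu, Or.inl rfl, h, fun w hw hw0 e => ?_⟩
    rcases hL.2 w hw u hu e with rfl | rfl
    · rfl
    · simp at hw0
      exact absurd hw0 h.not_gt

theorem IsGeneric.succMin_lt {L : UnimodularLattice} (hL : IsGeneric L) :
    succMin 1 L < succMin 2 L := by
  obtain ⟨u, hu, v, hv, hu0, huv, h1, h2⟩ := exists_pair_succMin L
  refine lt_of_le_of_ne (succMin_one_le_two L) fun h => huv ?_
  rcases hL.2 u hu v hv (by rw [h1, h2, h]) with rfl | rfl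
  · simp only [planeDet]; ring
  · simp only [planeDet, PiLp.neg_apply]; ring

/-- In a generic lattice each length belongs to at most one pair `±u`, and exactly one of the two
has positive first coordinate when `u ≠ 0`. -/
theorem IsGeneric.exists_minimalPair {L : UnimodularLattice} (hL : IsGeneric L) :
    ∃ p : Plane × Plane, IsMinimalPair L p ∧ planeDet p.1 p.2 ≠ 0 ∧
      ∀ q, IsMinimalPair L q → q = p := by
  obtain ⟨u, hu, v, hv, hu0, huv, h1, h2⟩ := exists_pair_succMin L
  have hv0 : v ≠ 0 := by rintro rfl; simp at huv
  obtain ⟨u', hu', eu, pu, hu''⟩ := hL.exists_pos_of_norm hu hu0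
  obtain ⟨v', hv', ev, pv, hv''⟩ := hL.exists_pos_of_norm hv hv0
  have nu : ‖u'‖ = ‖u‖ := by rcases eu with rfl | rfl <;> simp
  have nv : ‖v'‖ = ‖v‖ := by rcases ev with rfl | rfl <;> simp
  refine ⟨(u', v'), ⟨⟨hu', pu, nu.trans h1⟩, ⟨hv', pv, nv.trans h2⟩⟩, ?_, ?_⟩
  · rcases eu with rfl | rfl <;> rcases ev with rfl | rfl <;>
      simpa [planeDet_neg_left, planeDet_neg_right] using huv
  · rintro ⟨a, b⟩ ⟨⟨ha, pa, na⟩, ⟨hb, pb, nb⟩⟩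
    exact Prod.ext (hu'' a ha pa (na.trans h1.symm)) (hv'' b hb pb (nb.trans h2.symm))

theorem IsGeneric.existsUnique {L : UnimodularLattice} (hL : IsGeneric L) :
    ∃! v, IsMinimalPair L v := by
  obtain ⟨p, hp, _, hu⟩ := hL.exists_minimalPair
  exact ⟨p, hp, hu⟩

theorem minimalPair_spec {L : UnimodularLattice} (h : ∃! v, IsMinimalPair L v) :
    IsMinimalPair L (minimalPair L) := by
  rw [minimalPair, dif_pos h]
  exact h.choose_spec.1

theorem minimalPair_eq {L : UnimodularLattice} (h : ∃! v, IsMinimalPair L v) {p : Plane × Plane}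
    (hp : IsMinimalPair L p) : minimalPair L = p :=
  h.unique (minimalPair_spec h) hp

theorem IsGeneric.planeDet_minimalPair {L : UnimodularLattice} (hL : IsGeneric L) :
    planeDet (minimalPair L).1 (minimalPair L).2 ≠ 0 := by
  obtain ⟨p, hp, hd, hu⟩ := hL.exists_minimalPair
  rw [minimalPair_eq hL.existsUnique hp]
  exact hd

theorem norm_sq_combination (u v : Plane) (a b : ℝ) :
    ‖a • u + b • v‖ ^ 2 = a ^ 2 * ‖u‖ ^ 2 + 2 * a * b * (u 0 * v 0 + u 1 * v 1) +
      b ^ 2 * ‖v‖ ^ 2 := by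
  simp only [norm_sq_plane, PiLp.add_apply, PiLp.smul_apply, smul_eq_mul]
  ring

/-- The vectors `e₁(L), e₂(L)` are nearly orthogonal. -/
theorem IsGeneric.abs_inner_le {L : UnimodularLattice} (hL : IsGeneric L) :
    2 * |(minimalPair L).1 0 * (minimalPair L).2 0 + (minimalPair L).1 1 * (minimalPair L).2 1| ≤
      succMin 1 L ^ 2 := by
  obtain ⟨⟨hu, _, nu⟩, ⟨hv, _, nv⟩⟩ := minimalPair_spec hL.existsUnique
  have hd := hL.planeDet_minimalPair
  have hlt := hL.succMin_lt
  set u := (minimalPair L).1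
  set v := (minimalPair L).2
  -- Because `u` is strictly shorter than the second minimum, any vector off its line has at least
  -- that length. For `v ± u` this gives `‖v ± u‖ ≥ ‖v‖`, and expanding the squares bounds the inner
  -- product.
  have key : ∀ w ∈ L.vectors, planeDet u w ≠ 0 → succMin 2 L ≤ ‖w‖ := by
    intro w hw h
    have := succMin_two_le hu hw h
    rw [nu] at this
    rcases le_max_iff.1 this with h' | h'
    · exact absurd h' hlt.not_ge
    · exact h'
  have hp : 0 < succMin 1 L := succMin_one_pos L
  have h1 := key (v + u) (add_mem hv hu) (by
    have := planeDet_smul_add u v 1 1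
    rw [one_smul, one_smul, one_mul, add_comm] at this
    rwa [this])
  have h2 := key (v - u) (sub_mem hv hu) (by
    have := planeDet_smul_add u v (-1) 1
    rw [one_smul, neg_one_smul, one_mul, neg_add_eq_sub] at this
    rwa [this])
  have e1 := norm_sq_combination u v 1 1
  have e2 := norm_sq_combination u v (-1) 1
  rw [one_smul, one_smul, add_comm u v] at e1
  rw [one_smul, neg_one_smul, neg_add_eq_sub] at e2
  rw [nu, nv] at e1 e2
  have s1 := pow_le_pow_left₀ (hp.trans hlt).le h1 2
  have s2 := pow_le_pow_left₀ (hp.trans hlt).le h2 2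
  have : |u 0 * v 0 + u 1 * v 1| ≤ succMin 1 L ^ 2 / 2 := by
    rw [abs_le]
    constructor <;> linarith
  linarith

theorem indexNorm_eq (L : UnimodularLattice) (k : PrimeIndex) :
    indexNorm L k = ‖(k.1.1 : ℝ) • (minimalPair L).1 + (k.1.2 : ℝ) • (minimalPair L).2‖ := by
  simp only [indexNorm, Int.cast_smul_eq_zsmul]

/-- The coordinates of an index. -/
def PrimeIndex.vec (k : PrimeIndex) : Fin 2 → ℤ := ![k.1.1, k.1.2]

theorem PrimeIndex.vec_injective : Function.Injective PrimeIndex.vec := by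
  intro k l h
  apply Subtype.ext
  apply Prod.ext
  · simpa [vec] using congrFun h 0
  · simpa [vec] using congrFun h 1

instance : Countable PrimeIndex := PrimeIndex.vec_injective.countable

theorem PrimeIndex.vec_ne_zero (k : PrimeIndex) : k.vec ≠ 0 := by
  intro h
  have h0 : k.1.1 = 0 := by simpa [vec] using congrFun h 0
  have h1 : k.1.2 = 0 := by simpa [vec] using congrFun h 1
  have := k.2.1
  rw [h0, h1] at this
  simp at this

/-- By near orthogonality the cross term of the quadratic form is at most `|k₁k₂| ‖L‖₁²`, hence at
most half of `‖L‖₁² (k₁² + k₂²)`. The norm of `k.vec` is the sup norm, and the constant `2` is a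
convenient weakening of `√2`. -/
theorem IsGeneric.le_indexNorm {L : UnimodularLattice} (hL : IsGeneric L) (k : PrimeIndex) :
    succMin 1 L * ‖k.vec‖ ≤ 2 * indexNorm L k := by
  have hin := hL.abs_inner_le
  obtain ⟨⟨hu, _, nu⟩, ⟨hv, _, nv⟩⟩ := minimalPair_spec hL.existsUnique
  have hp := succMin_one_pos L
  have hle := succMin_one_le_two L
  have hN : 0 ≤ indexNorm L k := norm_nonneg _
  have e := norm_sq_combination (minimalPair L).1 (minimalPair L).2 k.1.1 k.1.2
  rw [← indexNorm_eq, nu, nv] at e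
  set I := (minimalPair L).1 0 * (minimalPair L).2 0 + (minimalPair L).1 1 * (minimalPair L).2 1
  set a : ℝ := ((k.1.1 : ℤ) : ℝ)
  set b : ℝ := ((k.1.2 : ℤ) : ℝ)
  set x := succMin 1 L
  set y := succMin 2 L
  have hsq : x ^ 2 ≤ y ^ 2 := pow_le_pow_left₀ hp.le hle 2
  have hab : -(|a * b| * x ^ 2) ≤ 2 * a * b * I := by
    have h1 : |2 * a * b * I| ≤ |a * b| * x ^ 2 := by
      have : 2 * a * b * I = (a * b) * (2 * I) := by ring
      rw [this, abs_mul, abs_mul 2 I, abs_two]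
      gcongr
    exact (abs_le.1 h1).1
  have hamgm : 2 * |a * b| ≤ a ^ 2 + b ^ 2 := by
    rw [abs_mul, ← sq_abs a, ← sq_abs b]
    nlinarith [sq_nonneg (|a| - |b|)]
  have hmain : x ^ 2 * (a ^ 2 + b ^ 2) ≤ 2 * indexNorm L k ^ 2 := by
    rw [e]
    nlinarith [mul_nonneg (sq_nonneg b) (sub_nonneg.2 hsq),
      mul_nonneg (sq_nonneg x) (sub_nonneg.2 hamgm)]
  have hm : ‖k.vec‖ ^ 2 ≤ a ^ 2 + b ^ 2 := by
    have : ‖k.vec‖ ≤ Real.sqrt (a ^ 2 + b ^ 2) := by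
      rw [pi_norm_le_iff_of_nonneg (Real.sqrt_nonneg _)]
      intro i
      fin_cases i
      · refine Real.le_sqrt_of_sq_le ?_
        simp only [PrimeIndex.vec, Int.norm_eq_abs, sq_abs]
        simpa [a] using sq_nonneg b
      · refine Real.le_sqrt_of_sq_le ?_
        simp only [PrimeIndex.vec, Int.norm_eq_abs, sq_abs]
        simpa [b] using sq_nonneg a
    calc ‖k.vec‖ ^ 2 ≤ Real.sqrt (a ^ 2 + b ^ 2) ^ 2 := pow_le_pow_left₀ (norm_nonneg _) this 2
      _ = _ := Real.sq_sqrt (by positivity)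
  refine abs_le_of_sq_le_sq' ?_ (by positivity) |>.2
  nlinarith [mul_le_mul_of_nonneg_left hm (sq_nonneg x), sq_nonneg (indexNorm L k)]

theorem IsGeneric.finite_primeIndexUpTo {L : UnimodularLattice} (hL : IsGeneric L) (A : ℝ) :
    (primeIndexUpTo A L).Finite := by
  have hp := succMin_one_pos L
  have hfin : (PrimeIndex.vec ⁻¹' Metric.closedBall 0 (2 * A / succMin 1 L)).Finite :=
    Set.Finite.preimage PrimeIndex.vec_injective.injOn
      (isCompact_closedBall _ _).finite_of_discrete
  refine hfin.subset fun k hk => ?_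
  simp only [Set.mem_preimage, mem_closedBall_zero_iff]
  rw [le_div_iff₀ hp]
  have := hL.le_indexNorm k
  have hk' : indexNorm L k ≤ A := hk
  linarith

theorem IsGeneric.indexNorm_pos {L : UnimodularLattice} (hL : IsGeneric L) (k : PrimeIndex) :
    0 < indexNorm L k := by
  have := hL.le_indexNorm k
  have h := mul_pos (succMin_one_pos L) (norm_pos_iff.2 k.vec_ne_zero)
  linarith

/-- The index `(1, 0)`. -/
def PrimeIndex.first : PrimeIndex := ⟨(1, 0), by decide⟩

theorem IsGeneric.indexNorm_first {L : UnimodularLattice} (hL : IsGeneric L) :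
    indexNorm L PrimeIndex.first = succMin 1 L := by
  rw [← (minimalPair_spec hL.existsUnique).1.2.2]
  simp [indexNorm, PrimeIndex.first]

end LatticeWeights

/-! ### Measurability of the lattice invariants -/

namespace LatticeWeights

open UnimodularLattice

theorem exists_intVec {g : SLTwo} {v : Plane} (h : v ∈ (mk g).vectors) :
    ∃ n, act g (intVec n) = v := by
  obtain ⟨n, hn⟩ := h
  exact ⟨n, hn.symm⟩

theorem intVec_ne_zero_iff (g : SLTwo) (n : Fin 2 → ℤ) : act g (intVec n) ≠ 0 ↔ n ≠ 0 := by
  refine not_congr ?_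
  rw [← act_zero g, (act_injective g).eq_iff]
  have : (0 : Plane) = intVec 0 := by apply plane_ext <;> simp
  rw [this, intVec_injective.eq_iff]

theorem measurable_succMin_one : Measurable (succMin 1) := by
  rw [← measurable_comp_mk_iff]
  refine measurable_of_Iio fun r => ?_
  have : succMin 1 ∘ mk ⁻¹' Set.Iio r =
      ⋃ n : {n : Fin 2 → ℤ // n ≠ 0}, {g | ‖act g (intVec n.1)‖ < r} := by
    ext g
    simp only [Set.mem_preimage, Function.comp_apply, Set.mem_Iio, Set.mem_iUnion, Set.mem_ofPred_eq]
    constructor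
    · intro h
      obtain ⟨u, hu, v, hv, hu0, huv, h1, h2⟩ := exists_pair_succMin (mk g)
      obtain ⟨n, rfl⟩ := exists_intVec hu
      exact ⟨⟨n, (intVec_ne_zero_iff g n).1 hu0⟩, h1.trans_lt h⟩
    · rintro ⟨n, hn⟩
      exact (succMin_one_le (act_intVec_mem g n.1) ((intVec_ne_zero_iff g n.1).2 n.2)).trans_lt hn
  rw [this]
  exact MeasurableSet.iUnion fun n =>
    measurableSet_lt (measurable_act_intVec n.1).norm measurable_const

theorem measurable_succMin_two : Measurable (succMin 2) := by
  rw [← measurable_comp_mk_iff]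
  refine measurable_of_Iio fun r => ?_
  have : succMin 2 ∘ mk ⁻¹' Set.Iio r =
      ⋃ n : {n : (Fin 2 → ℤ) × (Fin 2 → ℤ) // planeDet (intVec n.1) (intVec n.2) ≠ 0},
        {g | ‖act g (intVec n.1.1)‖ < r} ∩ {g | ‖act g (intVec n.1.2)‖ < r} := by
    ext g
    simp only [Set.mem_preimage, Function.comp_apply, Set.mem_Iio, Set.mem_iUnion,
      Set.mem_ofPred_eq, Set.mem_inter_iff]
    constructor
    · intro h
      have hle := succMin_one_le_two (mk g)
      obtain ⟨u, hu, v, hv, hu0, huv, h1, h2⟩ := exists_pair_succMin (mk g)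
      obtain ⟨n, rfl⟩ := exists_intVec hu
      obtain ⟨m, rfl⟩ := exists_intVec hv
      rw [planeDet_act] at huv
      exact ⟨⟨(n, m), huv⟩, by rw [h1]; exact hle.trans_lt h, by rw [h2]; exact h⟩
    · rintro ⟨n, hn, hm⟩
      refine (succMin_two_le (act_intVec_mem g n.1.1) (act_intVec_mem g n.1.2) ?_).trans_lt
        (max_lt hn hm)
      rw [planeDet_act]
      exact n.2
  rw [this]
  exact MeasurableSet.iUnion fun n =>
    (measurableSet_lt (measurable_act_intVec n.1.1).norm measurable_const).inter
      (measurableSet_lt (measurable_act_intVec n.1.2).norm measurable_const)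

theorem measurable_apply (i : Fin 2) : Measurable fun v : Plane => v i :=
  (PiLp.continuous_apply 2 _ i).measurable

theorem measurableSet_isGeneric : MeasurableSet {L | IsGeneric L} := by
  rw [← measurableSet_preimage_mk_iff]
  have : mk ⁻¹' {L | IsGeneric L} =
      (⋂ n : {n : Fin 2 → ℤ // n ≠ 0}, {g : SLTwo | act g (intVec n.1) 0 = 0}ᶜ) ∩
      ⋂ n : {n : (Fin 2 → ℤ) × (Fin 2 → ℤ) // ¬ (n.1 = n.2 ∨ intVec n.1 = - intVec n.2)},
        {g : SLTwo | ‖act g (intVec n.1.1)‖ = ‖act g (intVec n.1.2)‖}ᶜ := by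
    ext g
    simp only [Set.mem_preimage, Set.mem_ofPred_eq, Set.mem_inter_iff, Set.mem_iInter,
      Set.mem_compl_iff, Subtype.forall, Prod.forall, IsGeneric]
    have hneg : ∀ n m : Fin 2 → ℤ, act g (intVec n) = -act g (intVec m) ↔
        intVec n = -intVec m := by
      intro n m
      rw [← neg_one_smul ℝ (act g (intVec m)), ← act_smul, (act_injective g).eq_iff, neg_one_smul]
    refine and_congr ⟨fun h n hn => ?_, ?_⟩ ⟨fun h n m hnm e => hnm ?_, ?_⟩
    · exact h _ (act_intVec_mem g n) ((intVec_ne_zero_iff g n).2 hn)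
    · rintro h v hv hn
      obtain ⟨n, rfl⟩ := exists_intVec hv
      exact h n ((intVec_ne_zero_iff g n).1 hn)
    · have := h _ (act_intVec_mem g n) _ (act_intVec_mem g m) e
      rwa [(act_injective g).eq_iff, intVec_injective.eq_iff, hneg] at this
    · rintro h v hv w hw e
      obtain ⟨n, rfl⟩ := exists_intVec hv
      obtain ⟨m, rfl⟩ := exists_intVec hw
      rw [(act_injective g).eq_iff, intVec_injective.eq_iff, hneg]
      by_contra hc
      exact h n m hc e
  rw [this]
  refine MeasurableSet.inter (MeasurableSet.iInter fun n => MeasurableSet.compl ?_)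
    (MeasurableSet.iInter fun n => MeasurableSet.compl ?_)
  · exact measurableSet_eq_fun ((measurable_apply 0).comp (measurable_act_intVec n.1))
      measurable_const
  · exact measurableSet_eq_fun (measurable_act_intVec n.1.1).norm (measurable_act_intVec n.1.2).norm

theorem measurableSet_isMinimalPair (n : (Fin 2 → ℤ) × (Fin 2 → ℤ)) :
    MeasurableSet {g : SLTwo | IsMinimalPair (mk g) (act g (intVec n.1), act g (intVec n.2))} := by
  have h : ∀ (n : Fin 2 → ℤ) (f : UnimodularLattice → ℝ), Measurable f →
      MeasurableSet {g : SLTwo | act g (intVec n) ∈ (mk g).vectors ∧ 0 < act g (intVec n) 0 ∧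
        ‖act g (intVec n)‖ = f (mk g)} := by
    intro n f hf
    simp only [act_intVec_mem, true_and]
    exact (measurableSet_lt measurable_const
      ((measurable_apply 0).comp (measurable_act_intVec n))).inter
      (measurableSet_eq_fun (measurable_act_intVec n).norm (measurable_comp_mk_iff.2 hf))
  exact (h n.1 _ measurable_succMin_one).inter (h n.2 _ measurable_succMin_two)

/-- On the set `U n` of matrices for which the integer pair `n` alone yields a minimal pair, the
function is an explicit continuous one. These countably many measurable sets cover the locus of
uniqueness, and the function is the default `0` elsewhere. -/
theorem measurable_minimalPair : Measurable minimalPair := by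
  rw [← measurable_comp_mk_iff]
  intro B hB
  set q : SLTwo → (Fin 2 → ℤ) × (Fin 2 → ℤ) → Plane × Plane :=
    fun g n => (act g (intVec n.1), act g (intVec n.2)) with hq
  have hqinj : ∀ g, Function.Injective (q g) := by
    rintro g ⟨n, m⟩ ⟨n', m'⟩ h
    simp only [hq, Prod.mk.injEq, (act_injective g).eq_iff, intVec_injective.eq_iff] at h
    rw [h.1, h.2]
  have hqmeas : ∀ n, Measurable fun g => q g n := fun n =>
    (measurable_act_intVec n.1).prodMk (measurable_act_intVec n.2)
  set M : (Fin 2 → ℤ) × (Fin 2 → ℤ) → Set SLTwo := fun n => {g | IsMinimalPair (mk g) (q g n)}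
    with hM
  have hMm : ∀ n, MeasurableSet (M n) := measurableSet_isMinimalPair
  set U : (Fin 2 → ℤ) × (Fin 2 → ℤ) → Set SLTwo := fun n =>
    M n ∩ ⋂ m : {m // m ≠ n}, (M m.1)ᶜ with hU
  have hUm : ∀ n, MeasurableSet (U n) := fun n =>
    (hMm n).inter (MeasurableSet.iInter fun m => (hMm m.1).compl)
  have lift : ∀ g v, IsMinimalPair (mk g) v → ∃ n, v = q g n := by
    rintro g ⟨v, w⟩ ⟨⟨hv, _⟩, ⟨hw, _⟩⟩
    obtain ⟨n, rfl⟩ := exists_intVec hv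
    obtain ⟨m, rfl⟩ := exists_intVec hw
    exact ⟨(n, m), rfl⟩
  have hUeq : ∀ g n, g ∈ U n → (∃! v, IsMinimalPair (mk g) v) ∧ minimalPair (mk g) = q g n := by
    intro g n hg
    have hex : ∃! v, IsMinimalPair (mk g) v := by
      refine ⟨q g n, hg.1, fun v hv => ?_⟩
      obtain ⟨m, rfl⟩ := lift g v hv
      by_contra hne
      exact Set.mem_iInter.1 hg.2 ⟨m, fun h => hne (by rw [h])⟩ hv
    exact ⟨hex, minimalPair_eq hex hg.1⟩
  have hUcov : ∀ g, (∃! v, IsMinimalPair (mk g) v) → ∃ n, g ∈ U n := by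
    rintro g ⟨v, hv, huniq⟩
    obtain ⟨n, rfl⟩ := lift g v hv
    refine ⟨n, hv, Set.mem_iInter.2 fun m hm => m.2 (hqinj g (huniq _ hm))⟩
  have : minimalPair ∘ mk ⁻¹' B = (⋃ n, U n ∩ {g | q g n ∈ B}) ∪
      ((⋃ n, U n)ᶜ ∩ {_g | (0 : Plane × Plane) ∈ B}) := by
    ext g
    simp only [Set.mem_preimage, Function.comp_apply, Set.mem_union, Set.mem_iUnion,
      Set.mem_inter_iff, Set.mem_compl_iff, Set.mem_ofPred_eq]
    by_cases hg : ∃ n, g ∈ U n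
    · obtain ⟨n, hn⟩ := hg
      have e := (hUeq g n hn).2
      constructor
      · intro h
        exact Or.inl ⟨n, hn, e ▸ h⟩
      · rintro (⟨m, hm, hB'⟩ | ⟨h, _⟩)
        · rwa [(hUeq g m hm).2]
        · exact absurd ⟨n, hn⟩ h
    · have : minimalPair (mk g) = 0 := dif_neg fun h => hg (hUcov g h)
      rw [this]
      constructor
      · intro h
        exact Or.inr ⟨hg, h⟩
      · rintro (⟨m, hm, _⟩ | ⟨_, h⟩)
        · exact absurd ⟨m, hm⟩ hg
        · exact h
  rw [this]
  refine MeasurableSet.union (MeasurableSet.iUnion fun n => (hUm n).inter (hqmeas n hB)) ?_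
  exact (MeasurableSet.iUnion hUm).compl.inter (MeasurableSet.const _)

theorem measurable_indexNorm (k : PrimeIndex) : Measurable fun L => indexNorm L k := by
  simp only [indexNorm_eq]
  have h1 := measurable_minimalPair.fst
  have h2 := measurable_minimalPair.snd
  exact ((h1.const_smul (k.1.1 : ℝ)).add (h2.const_smul (k.1.2 : ℝ))).norm

/-! ### Shears and almost sure genericity -/

/-- Upper triangular unipotent matrices. -/
def shear (t : ℝ) : SLTwo := ⟨!![1, t; 0, 1], by simp⟩

theorem continuous_shear : Continuous shear := by
  refine Continuous.subtype_mk ?_ _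
  refine continuous_matrix fun i j => ?_
  fin_cases i <;> fin_cases j <;> simp <;> fun_prop

theorem shear_apply_zero (t : ℝ) (v : Plane) : act (shear t) v 0 = v 0 + t * v 1 := by
  rw [act_apply_zero]; simp [shear]

theorem shear_apply_one (t : ℝ) (v : Plane) : act (shear t) v 1 = v 1 := by
  rw [act_apply_one]; simp [shear]

/-- A set that almost every shear of every lattice avoids is null. -/
theorem measure_eq_zero_of_shear (μ : Measure UnimodularLattice) [SFinite μ]
    [SMulInvariantMeasure SLTwo UnimodularLattice μ] {B : Set UnimodularLattice}
    (hB : MeasurableSet B) (h : ∀ L, volume {t : ℝ | shear t • L ∈ B} = 0) : μ B = 0 := by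
  -- Fubini on `[0, 1] × 𝒮₂`: integrating over lattices first gives `μ B` by invariance, integrating
  -- over `t` first gives `0`.
  set ν : Measure ℝ := volume.restrict (Set.Icc 0 1)
  have hmeas : Measurable fun p : ℝ × UnimodularLattice => shear p.1 • p.2 :=
    ((continuous_shear.comp continuous_fst).smul continuous_snd).measurable
  have hS := hmeas hB
  have h1 := Measure.prod_apply (μ := ν) (ν := μ) hS
  have h2 := Measure.prod_apply_symm (μ := ν) (ν := μ) hS
  have e1 : ∀ t : ℝ, μ (Prod.mk t ⁻¹' ((fun p : ℝ × UnimodularLattice => shear p.1 • p.2) ⁻¹' B)) =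
      μ B := fun t => measure_preimage_smul μ (shear t) B
  have e2 : ∀ L : UnimodularLattice,
      ν ((fun t => (t, L)) ⁻¹' ((fun p : ℝ × UnimodularLattice => shear p.1 • p.2) ⁻¹' B)) = 0 :=
    fun L => le_antisymm ((Measure.restrict_apply_le _ _).trans (h L).le) zero_le
  simp only [e1, lintegral_const] at h1
  simp only [e2, lintegral_zero] at h2
  rw [h1] at h2
  simpa [ν] using h2

theorem finite_quadratic {a b c : ℝ} (h : a ≠ 0 ∨ b ≠ 0 ∨ c ≠ 0) :
    {t : ℝ | a * t ^ 2 + b * t + c = 0}.Finite := by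
  open Polynomial in
  have hp : (C a * X ^ 2 + C b * X + C c : ℝ[X]) ≠ 0 := by
    intro h0
    have h2 := congrArg (fun p : ℝ[X] => p.coeff 2) h0
    have h1 := congrArg (fun p : ℝ[X] => p.coeff 1) h0
    have hc := congrArg (fun p : ℝ[X] => p.coeff 0) h0
    simp [coeff_X, coeff_C] at h2 h1 hc
    simp [h2, h1, hc] at h
  refine (Polynomial.finite_setOfPred_isRoot hp).subset fun t ht => ?_
  simpa [Polynomial.IsRoot] using ht

/-- For given lattice vectors, each failure of genericity is a polynomial equation in `t` of degree
at most two. It is not an identity unless the vector is zero, respectively the two vectors agree up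
to sign, and there are countably many vectors. -/
theorem countable_not_isGeneric_shear (L : UnimodularLattice) :
    {t : ℝ | ¬ IsGeneric (shear t • L)}.Countable := by
  have hLc := countable_vectors L
  have hcount : ((⋃ v ∈ (L.vectors : Set Plane), {t : ℝ | v ≠ 0 ∧ act (shear t) v 0 = 0}) ∪
      ⋃ v ∈ (L.vectors : Set Plane), ⋃ w ∈ (L.vectors : Set Plane),
        {t : ℝ | ¬ (v = w ∨ v = -w) ∧ ‖act (shear t) v‖ = ‖act (shear t) w‖}).Countable := by
    refine Set.Countable.union (hLc.biUnion fun v _ => Set.Finite.countable ?_)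
      (hLc.biUnion fun v _ => hLc.biUnion fun w _ => Set.Finite.countable ?_)
    · by_cases hv : v = 0
      · simp [hv]
      · refine (finite_quadratic (a := 0) (b := v 1) (c := v 0) ?_).subset fun t ht => ?_
        · by_contra! h
          exact hv (plane_ext h.2.2 h.2.1)
        · have := ht.2
          rw [shear_apply_zero] at this
          simp only [Set.mem_ofPred_eq]
          linarith
    · by_cases hvw : v = w ∨ v = -w
      · simp [hvw]
      · refine (finite_quadratic (a := v 1 ^ 2 - w 1 ^ 2) (b := 2 * (v 0 * v 1 - w 0 * w 1))
          (c := v 0 ^ 2 + v 1 ^ 2 - w 0 ^ 2 - w 1 ^ 2) ?_).subset fun t ht => ?_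
        · by_contra! h
          obtain ⟨ha, hb, hc⟩ := h
          apply hvw
          -- Vanishing of the extreme coefficients makes each coordinate agree up to sign; the
          -- middle coefficient forces a common sign, unless a coordinate is zero.
          have h1 : (v 1 - w 1) * (v 1 + w 1) = 0 := by linarith
          have h0 : (v 0 - w 0) * (v 0 + w 0) = 0 := by linarith
          rcases mul_eq_zero.1 h1 with h1 | h1 <;> rcases mul_eq_zero.1 h0 with h0 | h0
          · exact Or.inl (plane_ext (by linarith) (by linarith))
          · have e1 : v 1 = w 1 := by linarith
            have e0 : v 0 = -w 0 := by linarith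
            have : w 0 * w 1 = 0 := by rw [e1, e0] at hb; linarith
            rcases mul_eq_zero.1 this with h | h
            · exact Or.inl (plane_ext (by rw [e0, h, neg_zero]) e1)
            · exact Or.inr (plane_ext e0 (by simp [e1, h]))
          · have e1 : v 1 = -w 1 := by linarith
            have e0 : v 0 = w 0 := by linarith
            have : w 0 * w 1 = 0 := by rw [e1, e0] at hb; linarith
            rcases mul_eq_zero.1 this with h | h
            · exact Or.inr (plane_ext (by simp [e0, h]) e1)
            · exact Or.inl (plane_ext e0 (by rw [e1, h, neg_zero]))
          · exact Or.inr (plane_ext (by simp; linarith) (by simp; linarith))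
        · have := congrArg (fun x => x ^ 2) ht.2
          simp only [norm_sq_plane, shear_apply_zero, shear_apply_one] at this
          simp only [Set.mem_ofPred_eq]
          linarith
  refine hcount.mono fun t ht => ?_
  simp only [Set.mem_union, Set.mem_iUnion, Set.mem_ofPred_eq, SetLike.mem_coe]
  have e : ∀ v, v = act (shear t) (act (shear t)⁻¹ v) := fun v => (act_act_inv _ v).symm
  rw [Set.mem_ofPred_eq, IsGeneric, not_and_or] at ht
  rcases ht with h | h
  · left
    push Not at h
    obtain ⟨v, hv, hv0, hv1⟩ := h
    refine ⟨_, mem_vectors_smul.1 hv, fun h => hv0 ?_, by rwa [act_act_inv]⟩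
    rw [e v, h, act_zero]
  · right
    push Not at h
    obtain ⟨v, hv, w, hw, heq, h1, h2⟩ := h
    refine ⟨_, mem_vectors_smul.1 hv, _, mem_vectors_smul.1 hw, ?_, by
      rwa [act_act_inv, act_act_inv]⟩
    rintro (h | h)
    · exact h1 ((act_injective _) h)
    · apply h2
      rw [e v, h, ← neg_one_smul ℝ, act_smul, act_act_inv, neg_one_smul]

theorem ae_isGeneric (μ : Measure UnimodularLattice) [SFinite μ]
    [SMulInvariantMeasure SLTwo UnimodularLattice μ] : ∀ᵐ L ∂μ, IsGeneric L :=
  measure_eq_zero_of_shear μ measurableSet_isGeneric.compl fun L =>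
    (countable_not_isGeneric_shear L).measure_zero _

end LatticeWeights

/-! ### Counting visible vectors and the measure of the cusp -/

namespace LatticeWeights

open UnimodularLattice

/-- The vectors of `L` that are visible from the origin. -/
def visible (L : UnimodularLattice) : Set Plane :=
  {v | v ∈ L.vectors ∧ v ≠ 0 ∧ ∀ t : ℝ, 0 < t → t < 1 → t • v ∉ L.vectors}

/-- The number of visible vectors of `L` in `E`. -/
noncomputable def visCount (E : Set Plane) (L : UnimodularLattice) : ℝ≥0∞ :=
  ∑' v : visible L, E.indicator 1 (v : Plane)

/-- Visibility is a condition on the integer coordinates only, so the counting function becomes a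
sum over an index set that does not depend on `g`. -/
theorem visible_mk (g : SLTwo) : visible (mk g) = (fun n => act g (intVec n)) ''
    {n | n ≠ 0 ∧ ∀ t : ℝ, 0 < t → t < 1 → ∀ m, t • intVec n ≠ intVec m} := by
  have key : ∀ n, act g (intVec n) ∈ visible (mk g) ↔
      n ≠ 0 ∧ ∀ t : ℝ, 0 < t → t < 1 → ∀ m, t • intVec n ≠ intVec m := by
    intro n
    have h : ∀ t : ℝ, t • act g (intVec n) ∉ (mk g).vectors ↔ ∀ m, t • intVec n ≠ intVec m := by
      intro t
      rw [mem_vectors_mk]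
      push Not
      refine forall_congr' fun m => ?_
      rw [← act_smul, (act_injective g).ne_iff]
    change _ ∧ _ ∧ _ ↔ _
    rw [intVec_ne_zero_iff]
    simp only [act_intVec_mem, true_and, h]
  ext v
  constructor
  · intro hv
    obtain ⟨n, rfl⟩ := exists_intVec hv.1
    exact ⟨n, (key n).1 hv, rfl⟩
  · rintro ⟨n, hn, rfl⟩
    exact (key n).2 hn

theorem visible_smul (h : SLTwo) (L : UnimodularLattice) :
    visible (h • L) = act h '' visible L := by
  ext v
  have hv : act h⁻¹ v ∈ visible L ↔ v ∈ visible (h • L) := by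
    have h0 : act h⁻¹ v ≠ 0 ↔ v ≠ 0 := by
      exact (act_injective h⁻¹).ne_iff' (act_zero h⁻¹)
    simp only [visible, Set.mem_ofPred_eq, mem_vectors_smul, h0, act_smul]
  rw [← hv]
  constructor
  · intro h'
    exact ⟨_, h', act_act_inv _ _⟩
  · rintro ⟨w, hw, rfl⟩
    rwa [act_inv_act]

theorem visCount_smul (E : Set Plane) (h : SLTwo) (L : UnimodularLattice) :
    visCount E (h • L) = visCount (act h ⁻¹' E) L := by
  rw [visCount, visible_smul, tsum_image (fun v => E.indicator 1 v) (act_injective h).injOn]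
  rfl

theorem measurable_visCount {E : Set Plane} (hE : MeasurableSet E) : Measurable (visCount E) := by
  rw [← measurable_comp_mk_iff]
  have : visCount E ∘ mk = fun g => ∑' n : {n : Fin 2 → ℤ | n ≠ 0 ∧
      ∀ t : ℝ, 0 < t → t < 1 → ∀ m, t • intVec n ≠ intVec m},
        E.indicator 1 (act g (intVec n)) := by
    ext g
    rw [Function.comp_apply, visCount, visible_mk, tsum_image (fun v => E.indicator 1 v)]
    intro n _ m _ h
    exact intVec_injective (act_injective g h)
  rw [this]
  exact Measurable.tsum fun n =>
    (measurable_const.indicator hE).comp (measurable_act_intVec n.1)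

theorem one_le_visCount {E : Set Plane} {L : UnimodularLattice} {v : Plane} (hv : v ∈ visible L)
    (hE : v ∈ E) : 1 ≤ visCount E L := by
  refine le_trans ?_ (ENNReal.le_tsum (⟨v, hv⟩ : visible L))
  simp [hE]

theorem visCount_union {E F : Set Plane} (h : Disjoint E F) (L : UnimodularLattice) :
    visCount (E ∪ F) L = visCount E L + visCount F L := by
  simp only [visCount, Set.indicator_union_of_disjoint h]
  exact ENNReal.tsum_add

/-- The mean number of visible vectors in `E`. -/
noncomputable def visMean (μ : Measure UnimodularLattice) (E : Set Plane) : ℝ≥0∞ :=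
  ∫⁻ L, visCount E L ∂μ

theorem visMean_preimage (μ : Measure UnimodularLattice)
    [SMulInvariantMeasure SLTwo UnimodularLattice μ] {E : Set Plane} (hE : MeasurableSet E)
    (h : SLTwo) :
    visMean μ (act h ⁻¹' E) = visMean μ E := by
  simp only [visMean, ← visCount_smul]
  have hm : MeasurePreserving (h • · : UnimodularLattice → UnimodularLattice) μ μ :=
    measurePreserving_smul h μ
  exact hm.lintegral_comp (measurable_visCount hE)

theorem visMean_union (μ : Measure UnimodularLattice) {E F : Set Plane} (hE : MeasurableSet E)
    (h : Disjoint E F) : visMean μ (E ∪ F) = visMean μ E + visMean μ F := by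
  simp only [visMean, visCount_union h]
  exact lintegral_add_left (measurable_visCount hE) _

/-- The triangle between two lines through the origin and a horizontal line. -/
def sector (a b r : ℝ) : Set Plane := {v | (0 < v 1 ∧ v 1 < r) ∧ a * v 1 ≤ v 0 ∧ v 0 < b * v 1}

theorem measurableSet_sector (a b r : ℝ) : MeasurableSet (sector a b r) := by
  have h0 := measurable_apply 0
  have h1 := measurable_apply 1
  exact ((measurableSet_lt measurable_const h1).inter (measurableSet_lt h1 measurable_const)).inter
    ((measurableSet_le (h1.const_mul a) h0).inter (measurableSet_lt h0 (h1.const_mul b)))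

theorem preimage_shear_sector (t a b r : ℝ) :
    act (shear t) ⁻¹' sector a b r = sector (a - t) (b - t) r := by
  ext v
  simp only [sector, Set.mem_preimage, Set.mem_ofPred_eq, shear_apply_zero, shear_apply_one]
  refine and_congr_right fun _ => and_congr ?_ ?_ <;> constructor <;> intro h <;> linarith

/-- The diagonal matrix with entries `2` and `1 / 2`. -/
noncomputable def dilation : SLTwo := ⟨!![2, 0; 0, 1 / 2], by simp⟩

theorem preimage_dilation_sector (a b r : ℝ) :
    act dilation ⁻¹' sector (4 * a) (4 * b) r = sector a b (2 * r) := by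
  ext v
  have h0 : act dilation v 0 = 2 * v 0 := by rw [act_apply_zero]; simp [dilation]
  have h1 : act dilation v 1 = 1 / 2 * v 1 := by rw [act_apply_one]; simp [dilation]
  simp only [sector, Set.mem_preimage, Set.mem_ofPred_eq, h0, h1]
  refine and_congr (and_congr ?_ ?_) (and_congr ?_ ?_) <;> constructor <;> intro h <;> linarith

theorem visMean_sector_add (μ : Measure UnimodularLattice) {a b c : ℝ} (r : ℝ) (hab : a ≤ b)
    (hbc : b ≤ c) : visMean μ (sector a c r) = visMean μ (sector a b r) +
      visMean μ (sector b c r) := by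
  rw [← visMean_union μ (measurableSet_sector a b r)]
  · congr 1
    ext v
    simp only [sector, Set.mem_union, Set.mem_ofPred_eq]
    constructor
    · rintro ⟨h, h1, h2⟩
      rcases lt_or_ge (v 0) (b * v 1) with h3 | h3
      · exact Or.inl ⟨h, h1, h3⟩
      · exact Or.inr ⟨h, h3, h2⟩
    · rintro (⟨h, h1, h2⟩ | ⟨h, h1, h2⟩)
      · exact ⟨h, h1, h2.trans_le (by gcongr; exact h.1.le)⟩
      · exact ⟨h, le_trans (by gcongr; exact h.1.le) h1, h2⟩
  · rw [Set.disjoint_left]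
    rintro v ⟨_, _, h1⟩ ⟨_, h2, _⟩
    exact absurd h1 h2.not_gt

/-- The diagonal matrix with entries `2, 1/2` turns the doubled triangle into one of the original
height with slopes in `[-4, 4)`. It splits into four pieces of slope width `2`, all shears of the
original triangle. -/
theorem visMean_sector_two_mul (μ : Measure UnimodularLattice)
    [SMulInvariantMeasure SLTwo UnimodularLattice μ] (r : ℝ) :
    visMean μ (sector (-1) 1 (2 * r)) = 4 * visMean μ (sector (-1) 1 r) := by
  have hs : ∀ t, visMean μ (sector (-1 - t) (1 - t) r) = visMean μ (sector (-1) 1 r) := fun t => by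
    rw [← preimage_shear_sector, visMean_preimage μ (measurableSet_sector _ _ _)]
  rw [← preimage_dilation_sector, visMean_preimage μ (measurableSet_sector _ _ _),
    visMean_sector_add μ r (b := 0) (by norm_num) (by norm_num),
    visMean_sector_add μ r (a := 4 * -1) (b := -2) (by norm_num) (by norm_num),
    visMean_sector_add μ r (c := 4 * 1) (b := 2) (by norm_num) (by norm_num)]
  have h1 := hs 3
  have h2 := hs 1
  have h3 := hs (-1)
  have h4 := hs (-3)
  norm_num at h1 h2 h3 h4 ⊢
  rw [h1, h2, h3, h4]
  ring

theorem visMean_sector_two_pow (μ : Measure UnimodularLattice)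
    [SMulInvariantMeasure SLTwo UnimodularLattice μ] (n : ℕ) (r : ℝ) :
    visMean μ (sector (-1) 1 (2 ^ n * r)) = 4 ^ n * visMean μ (sector (-1) 1 r) := by
  induction n with
  | zero => simp
  | succ n ih => rw [pow_succ', mul_assoc, visMean_sector_two_mul, ih, pow_succ', mul_assoc]

/-- The rotation by a right angle. -/
def rotation : SLTwo := ⟨!![0, -1; 1, 0], by simp⟩

theorem rotation_apply_zero (v : Plane) : act rotation v 0 = -v 1 := by
  rw [act_apply_zero]; simp [rotation]

theorem rotation_apply_one (v : Plane) : act rotation v 1 = v 0 := by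
  rw [act_apply_one]; simp [rotation]

/-- The quarter turns of the half-open cone `-y ≤ x < y`, `y > 0`, tile the punctured plane. -/
theorem exists_rotation_mem_sector {v : Plane} (hv : v ≠ 0) {r : ℝ} (hr : ‖v‖ < r) :
    ∃ i : Fin 4, act (rotation ^ (i : ℕ)) v ∈ sector (-1) 1 r := by
  have h0 := abs_le.1 (PiLp.norm_apply_le v 0)
  have h1 := abs_le.1 (PiLp.norm_apply_le v 1)
  have hne : v 0 ≠ 0 ∨ v 1 ≠ 0 := by
    by_contra! h
    exact hv (plane_ext h.1 h.2)
  have e0 : act (rotation ^ 0) v ∈ sector (-1) 1 r ↔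
      (0 < v 1 ∧ v 1 < r) ∧ -1 * v 1 ≤ v 0 ∧ v 0 < 1 * v 1 := by
    rw [pow_zero, act_one]; rfl
  have e1 : act (rotation ^ 1) v ∈ sector (-1) 1 r ↔
      (0 < v 0 ∧ v 0 < r) ∧ -1 * v 0 ≤ -v 1 ∧ -v 1 < 1 * v 0 := by
    rw [pow_one, sector, Set.mem_ofPred_eq, rotation_apply_zero, rotation_apply_one]
  have e2 : act (rotation ^ 2) v ∈ sector (-1) 1 r ↔
      (0 < -v 1 ∧ -v 1 < r) ∧ -1 * -v 1 ≤ -v 0 ∧ -v 0 < 1 * -v 1 := by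
    rw [pow_two, act_mul, sector, Set.mem_ofPred_eq]
    simp only [rotation_apply_zero, rotation_apply_one]
  have e3 : act (rotation ^ 3) v ∈ sector (-1) 1 r ↔
      (0 < -v 0 ∧ -v 0 < r) ∧ -1 * -v 0 ≤ - -v 1 ∧ - -v 1 < 1 * -v 0 := by
    rw [pow_succ, pow_two, act_mul, act_mul, sector, Set.mem_ofPred_eq]
    simp only [rotation_apply_zero, rotation_apply_one]
  rcases lt_trichotomy (v 0) (v 1) with a | a | a <;>
    rcases lt_trichotomy (v 0) (-v 1) with b | b | b
  · exact ⟨3, e3.2 ⟨⟨by linarith, by linarith⟩, by linarith, by linarith⟩⟩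
  · exact ⟨0, e0.2 ⟨⟨by linarith, by linarith⟩, by linarith, by linarith⟩⟩
  · exact ⟨0, e0.2 ⟨⟨by linarith, by linarith⟩, by linarith, by linarith⟩⟩
  · exact ⟨3, e3.2 ⟨⟨by linarith, by linarith⟩, by linarith, by linarith⟩⟩
  · rcases hne with h | h
    · exact absurd (by linarith : v 0 = 0) h
    · exact absurd (by linarith : v 1 = 0) h
  · exact ⟨1, e1.2 ⟨⟨by linarith, by linarith⟩, by linarith, by linarith⟩⟩
  · exact ⟨2, e2.2 ⟨⟨by linarith, by linarith⟩, by linarith, by linarith⟩⟩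
  · exact ⟨2, e2.2 ⟨⟨by linarith, by linarith⟩, by linarith, by linarith⟩⟩
  · exact ⟨1, e1.2 ⟨⟨by linarith, by linarith⟩, by linarith, by linarith⟩⟩

theorem exists_mem_visible (L : UnimodularLattice) : ∃ v ∈ visible L, ‖v‖ = succMin 1 L := by
  obtain ⟨u, hu, v, hv, hu0, huv, h1, h2⟩ := exists_pair_succMin L
  refine ⟨u, ⟨hu, hu0, fun t ht ht1 hmem => ?_⟩, h1⟩
  have := succMin_one_le hmem (smul_ne_zero ht.ne' hu0)
  rw [norm_smul, Real.norm_of_nonneg ht.le, ← h1] at this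
  nlinarith [norm_pos_iff.2 hu0]

/-- A shortest vector is visible, and one of the four rotated triangles contains it; invariance
gives the four the same mean. -/
theorem measure_succMin_lt_le (μ : Measure UnimodularLattice)
    [SMulInvariantMeasure SLTwo UnimodularLattice μ] (r : ℝ) :
    μ {L | succMin 1 L < r} ≤ 4 * visMean μ (sector (-1) 1 r) := by
  have hmeas : ∀ i : Fin 4, MeasurableSet (act (rotation ^ (i : ℕ)) ⁻¹' sector (-1) 1 r) :=
    fun i => (continuous_act.comp (Continuous.prodMk_right _)).measurable
      (measurableSet_sector (-1) 1 r)
  calc μ {L | succMin 1 L < r}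
      = ∫⁻ L, {L | succMin 1 L < r}.indicator 1 L ∂μ :=
        (lintegral_indicator_one (measurableSet_lt measurable_succMin_one measurable_const)).symm
    _ ≤ ∫⁻ L, ∑ i : Fin 4, visCount (act (rotation ^ (i : ℕ)) ⁻¹' sector (-1) 1 r) L ∂μ := by
        refine lintegral_mono fun L => ?_
        refine Set.indicator_le (s := {L | succMin 1 L < r}) (f := 1) (g := fun L =>
          ∑ i : Fin 4, visCount (act (rotation ^ (i : ℕ)) ⁻¹' sector (-1) 1 r) L)
          (fun L hL => ?_) L
        obtain ⟨v, hv, hn⟩ := exists_mem_visible L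
        obtain ⟨i, hi⟩ := exists_rotation_mem_sector hv.2.1 (r := r) (hn.trans_lt hL)
        exact (one_le_visCount hv hi).trans
          (Finset.single_le_sum (f := fun i : Fin 4 =>
            visCount (act (rotation ^ (i : ℕ)) ⁻¹' sector (-1) 1 r) L)
            (fun _ _ => zero_le) (Finset.mem_univ i))
    _ = ∑ i : Fin 4, visMean μ (act (rotation ^ (i : ℕ)) ⁻¹' sector (-1) 1 r) :=
        lintegral_finsetSum _ fun i _ => measurable_visCount (hmeas i)
    _ = 4 * visMean μ (sector (-1) 1 r) := by
        simp [visMean_preimage μ (measurableSet_sector _ _ _)]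

theorem exists_int_planeDet {L : UnimodularLattice} {v w : Plane} (hv : v ∈ L.vectors)
    (hw : w ∈ L.vectors) : ∃ m : ℤ, planeDet v w = m := by
  obtain ⟨g, rfl⟩ := mk_surjective L
  obtain ⟨n, rfl⟩ := exists_intVec hv
  obtain ⟨m, rfl⟩ := exists_intVec hw
  rw [planeDet_act]
  exact ⟨n 0 * m 1 - n 1 * m 0, by simp [planeDet]⟩

/-- In so small a triangle the determinant of two lattice vectors is an integer of absolute value
below `1`, hence `0`. The vectors are then positive multiples of each other, and visibility makes
them equal. -/
theorem visible_sector_subsingleton {L : UnimodularLattice} {r : ℝ} (hr : r ≤ 1 / 2)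
    {v w : Plane} (hv : v ∈ visible L) (hw : w ∈ visible L) (hvs : v ∈ sector (-1) 1 r)
    (hws : w ∈ sector (-1) 1 r) : v = w := by
  obtain ⟨⟨v1, v2⟩, v3, v4⟩ := hvs
  obtain ⟨⟨w1, w2⟩, w3, w4⟩ := hws
  obtain ⟨m, hm⟩ := exists_int_planeDet hv.1 hw.1
  have hd : |planeDet v w| < 1 := by
    have hvw : v 1 * w 1 < 1 / 4 := by nlinarith
    rw [planeDet, abs_lt]
    constructor <;> nlinarith
  rw [hm, ← Int.cast_abs] at hd
  have hm0 : m = 0 := Int.abs_lt_one_iff.1 (by exact_mod_cast hd)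
  rw [hm0, planeDet, Int.cast_zero] at hm
  have e1 : w = (w 1 / v 1) • v := by
    apply plane_ext
    · simp; field_simp; linarith
    · simp; field_simp
  have e2 : v = (v 1 / w 1) • w := by
    apply plane_ext
    · simp; field_simp; linarith
    · simp; field_simp
  rcases lt_trichotomy (v 1) (w 1) with h | h | h
  · exfalso
    refine hw.2.2 (v 1 / w 1) (by positivity) ((div_lt_one w1).2 h) ?_
    rw [← e2]
    exact hv.1
  · rw [e2, h, div_self w1.ne', one_smul]
  · exfalso
    refine hv.2.2 (w 1 / v 1) (by positivity) ((div_lt_one v1).2 h) ?_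
    rw [← e1]
    exact hw.1

/-- The count is at most one, and a counted vector has length below `√2 r < 2r`. -/
theorem visCount_sector_le {r : ℝ} (hr : r ≤ 1 / 2) (L : UnimodularLattice) :
    visCount (sector (-1) 1 r) L ≤ {L | succMin 1 L < 2 * r}.indicator 1 L := by
  by_cases h : ∃ v ∈ visible L, v ∈ sector (-1) 1 r
  · obtain ⟨v, hv, hvs⟩ := h
    have hlt : succMin 1 L < 2 * r := by
      refine (succMin_one_le hv.1 hv.2.1).trans_lt ?_
      obtain ⟨⟨v1, v2⟩, v3, v4⟩ := hvs
      have := norm_sq_plane v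
      refine lt_of_pow_lt_pow_left₀ 2 (by linarith) ?_
      nlinarith
    rw [Set.indicator_of_mem (by exact hlt), visCount, tsum_eq_single (⟨v, hv⟩ : visible L)]
    · exact Set.indicator_le' (fun _ _ => le_rfl) (fun _ _ => zero_le) _
    · rintro ⟨w, hw⟩ hne
      refine Set.indicator_of_notMem (fun hws => hne ?_) _
      exact Subtype.ext (visible_sector_subsingleton hr hw hv hws hvs)
  · have : visCount (sector (-1) 1 r) L = 0 := by
      rw [visCount, ENNReal.tsum_eq_zero]
      rintro ⟨w, hw⟩
      exact Set.indicator_of_notMem (fun hws => h ⟨w, hw, hws⟩) _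
    rw [this]
    exact zero_le

theorem visMean_sector_le (μ : Measure UnimodularLattice) {r : ℝ} (hr : r ≤ 1 / 2) :
    visMean μ (sector (-1) 1 r) ≤ μ {L | succMin 1 L < 2 * r} := by
  rw [← lintegral_indicator_one (measurableSet_lt measurable_succMin_one measurable_const)]
  exact lintegral_mono fun L => visCount_sector_le hr L

/-- If this mean vanished, scaling would annihilate it at all heights `2ⁿ/2`, and almost every
lattice would have an infinite first minimum. -/
theorem visMean_sector_half_ne_zero (μ : Measure UnimodularLattice) [IsProbabilityMeasure μ]
    [SMulInvariantMeasure SLTwo UnimodularLattice μ] :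
    visMean μ (sector (-1) 1 (1 / 2)) ≠ 0 := by
  intro h
  have h1 : ∀ n : ℕ, μ {L | succMin 1 L < 2 ^ n * (1 / 2)} = 0 := fun n =>
    le_antisymm ((measure_succMin_lt_le μ _).trans (by rw [visMean_sector_two_pow, h]; simp)) zero_le
  have h2 : (⋃ n : ℕ, {L | succMin 1 L < 2 ^ n * (1 / 2)}) = Set.univ := by
    refine Set.eq_univ_of_forall fun L => Set.mem_iUnion.2 ?_
    obtain ⟨n, hn⟩ := pow_unbounded_of_one_lt (2 * succMin 1 L) one_lt_two
    exact ⟨n, by simp only [Set.mem_ofPred_eq]; linarith⟩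
  have h3 := measure_iUnion_null h1
  rw [h2, measure_univ] at h3
  exact one_ne_zero h3

theorem visMean_sector_inv_two_pow (μ : Measure UnimodularLattice)
    [SMulInvariantMeasure SLTwo UnimodularLattice μ] (n : ℕ) (r : ℝ) :
    4 ^ n * visMean μ (sector (-1) 1 ((1 / 2) ^ n * r)) = visMean μ (sector (-1) 1 r) := by
  rw [← visMean_sector_two_pow, ← mul_assoc, ← mul_pow]
  norm_num

/-- Lattices with a vector of length less than `2 ^ (-n)` have measure `O(4 ^ (-n))`. -/
theorem four_pow_mul_measure_le (μ : Measure UnimodularLattice) [IsProbabilityMeasure μ]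
    [SMulInvariantMeasure SLTwo UnimodularLattice μ] (n : ℕ) :
    4 ^ n * μ {L | succMin 1 L < (1 / 2) ^ n} ≤ 16 := by
  have h1 := measure_succMin_lt_le μ ((1 / 2) ^ n)
  have h2 : visMean μ (sector (-1) 1 1) ≤ 4 := by
    have := visMean_sector_two_mul μ (1 / 2)
    norm_num at this ⊢
    rw [this]
    calc 4 * visMean μ (sector (-1) 1 (1 / 2)) ≤ 4 * 1 := by
          gcongr
          exact (visMean_sector_le μ le_rfl).trans prob_le_one
      _ = 4 := mul_one _
  have h3 := visMean_sector_inv_two_pow μ n 1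
  rw [mul_one] at h3
  calc 4 ^ n * μ {L | succMin 1 L < (1 / 2) ^ n}
      ≤ 4 ^ n * (4 * visMean μ (sector (-1) 1 ((1 / 2) ^ n))) := by gcongr
    _ = 4 * (4 ^ n * visMean μ (sector (-1) 1 ((1 / 2) ^ n))) := by ring
    _ ≤ 4 * 4 := by rw [h3]; gcongr
    _ = 16 := by norm_num

/-- The constant is the mean for height `1/2`; scaling to height `2⁻ⁿ/2` divides it by `4ⁿ`, and the
vectors counted there are shorter than `2⁻ⁿ`. -/
theorem exists_le_four_pow_mul_measure (μ : Measure UnimodularLattice) [IsProbabilityMeasure μ]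
    [SMulInvariantMeasure SLTwo UnimodularLattice μ] :
    ∃ c : ℝ≥0∞, c ≠ 0 ∧ ∀ n : ℕ, c ≤ 4 ^ n * μ {L | succMin 1 L < (1 / 2) ^ n} := by
  refine ⟨_, visMean_sector_half_ne_zero μ, fun n => ?_⟩
  rw [← visMean_sector_inv_two_pow μ n]
  gcongr
  refine (visMean_sector_le μ ?_).trans (measure_mono fun L hL => ?_)
  · have : (1 / 2 : ℝ) ^ n ≤ 1 := pow_le_one₀ (by norm_num) (by norm_num)
    linarith
  · simp only [Set.mem_ofPred_eq] at hL ⊢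
    linarith

/-! ### Negative moments of the first minimum -/

theorem measurable_succMin_rpow (s : ℝ) :
    Measurable fun L => ENNReal.ofReal (succMin 1 L ^ s) :=
  (measurable_succMin_one.pow_const s).ennreal_ofReal

/-- Dyadic decomposition: where the minimum is about `2⁻ⁿ` the integrand is of order `2^(sn)` and
the measure is `O(4⁻ⁿ)`, so the series is geometric of ratio `2^s / 4 < 1`. -/
theorem lintegral_succMin_rpow_ne_top (μ : Measure UnimodularLattice) [IsProbabilityMeasure μ]
    [SMulInvariantMeasure SLTwo UnimodularLattice μ] {s : ℝ} (hs : 0 ≤ s) (hs2 : s < 2) :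
    ∫⁻ L, ENNReal.ofReal (succMin 1 L ^ (-s)) ∂μ ≠ ∞ := by
  set q : ℝ≥0∞ := ENNReal.ofReal (2 ^ s) with hq
  set A : ℕ → Set UnimodularLattice := fun n => {L | succMin 1 L < (1 / 2) ^ n} with hA
  have hAm : ∀ n, MeasurableSet (A n) := fun n =>
    measurableSet_lt measurable_succMin_one measurable_const
  have hpt : ∀ L, ENNReal.ofReal (succMin 1 L ^ (-s)) ≤
      q + ∑' n : ℕ, (q ^ 2 * q ^ n) * (A n).indicator 1 L := by
    intro L
    have hp := succMin_one_pos L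
    rcases le_or_gt (1 / 2) (succMin 1 L) with h | h
    · refine le_trans (ENNReal.ofReal_le_ofReal ?_) le_self_add
      calc succMin 1 L ^ (-s) ≤ (1 / 2 : ℝ) ^ (-s) :=
            Real.rpow_le_rpow_of_nonpos (by norm_num) h (by linarith)
        _ = 2 ^ s := by rw [Real.rpow_neg (by norm_num), one_div, Real.inv_rpow (by norm_num),
            inv_inv]
    -- Locating twice the minimum leaves room for the strict inequality that defines `A n`; the
    -- factor `q ^ 2` pays for the two lost powers.
    · obtain ⟨n, hn1, hn2⟩ := exists_nat_pow_near_of_lt_one (x := 2 * succMin 1 L)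
        (y := 1 / 2) (by linarith) (by linarith) (by norm_num) (by norm_num)
      refine le_trans ?_ le_add_self
      refine le_trans ?_ (ENNReal.le_tsum n)
      have hmem : L ∈ A n := by simp only [hA, Set.mem_ofPred_eq]; linarith
      rw [Set.indicator_of_mem hmem, Pi.one_apply, mul_one, ← pow_add, hq, ← ENNReal.ofReal_pow
        (by positivity)]
      refine ENNReal.ofReal_le_ofReal ?_
      have h1 : (1 / 2 : ℝ) ^ (2 + n) ≤ succMin 1 L := by
        rw [pow_add, pow_two]
        rw [pow_succ] at hn1
        linarith
      calc succMin 1 L ^ (-s) ≤ ((1 / 2 : ℝ) ^ (2 + n)) ^ (-s) :=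
            Real.rpow_le_rpow_of_nonpos (by positivity) h1 (by linarith)
        _ = (2 ^ s) ^ (2 + n) := by
            rw [Real.rpow_neg (by positivity), one_div, inv_pow, Real.inv_rpow (by positivity),
              inv_inv, ← Real.rpow_natCast, ← Real.rpow_natCast, ← Real.rpow_mul (by norm_num),
              ← Real.rpow_mul (by norm_num), mul_comm]
  have hq4 : q / 4 < 1 := by
    rw [ENNReal.div_lt_iff (by simp) (by simp), one_mul, hq,
      show (4 : ℝ≥0∞) = ENNReal.ofReal 4 by simp]
    refine (ENNReal.ofReal_lt_ofReal_iff (by norm_num)).2 ?_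
    calc (2 : ℝ) ^ s < 2 ^ (2 : ℝ) := Real.rpow_lt_rpow_of_exponent_lt (by norm_num) hs2
      _ = 4 := by norm_num
  have hbound : ∀ n, (q ^ 2 * q ^ n) * μ (A n) ≤ 16 * q ^ 2 * (q / 4) ^ n := by
    intro n
    have h := four_pow_mul_measure_le μ n
    have h4 : (4 : ℝ≥0∞) ^ n ≠ 0 := by simp
    have h4' : (4 : ℝ≥0∞) ^ n ≠ ∞ := by simp
    have h' : μ (A n) ≤ 16 / 4 ^ n := by
      rw [ENNReal.le_div_iff_mul_le (Or.inl h4) (Or.inl h4'), mul_comm]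
      exact h
    calc (q ^ 2 * q ^ n) * μ (A n) ≤ (q ^ 2 * q ^ n) * (16 / 4 ^ n) := by gcongr
      _ = 16 * q ^ 2 * (q / 4) ^ n := by
        rw [div_eq_mul_inv, div_eq_mul_inv, mul_pow, ENNReal.inv_pow]; ring
  have : ∫⁻ L, ENNReal.ofReal (succMin 1 L ^ (-s)) ∂μ ≤
      q + 16 * q ^ 2 * (1 - q / 4)⁻¹ := by
    calc _ ≤ ∫⁻ L, (q + ∑' n : ℕ, (q ^ 2 * q ^ n) * (A n).indicator 1 L) ∂μ :=
          lintegral_mono hpt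
      _ = q + ∑' n : ℕ, (q ^ 2 * q ^ n) * μ (A n) := by
          have hm : ∀ n, Measurable ((A n).indicator (1 : UnimodularLattice → ℝ≥0∞)) :=
            fun n => measurable_const.indicator (hAm n)
          rw [lintegral_add_left measurable_const, lintegral_const, measure_univ, mul_one,
            lintegral_tsum fun n => ((hm n).const_mul _).aemeasurable]
          congr 2
          ext n
          rw [lintegral_const_mul _ (hm n), lintegral_indicator_one (hAm n)]
      _ ≤ q + ∑' n : ℕ, 16 * q ^ 2 * (q / 4) ^ n := by
          exact add_le_add_right (ENNReal.tsum_le_tsum hbound) q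
      _ = _ := by rw [ENNReal.tsum_mul_left, ENNReal.tsum_geometric]
  refine ne_top_of_le_ne_top ?_ this
  refine ENNReal.add_ne_top.2 ⟨ENNReal.ofReal_ne_top, ENNReal.mul_ne_top ?_ ?_⟩
  · exact ENNReal.mul_ne_top (by simp) (ENNReal.pow_ne_top ENNReal.ofReal_ne_top)
  · exact ENNReal.inv_ne_top.2 (tsub_pos_of_lt hq4).ne'

/-- Were the integral finite, absolute continuity would send its part over `A n` to `0`. But on `A
n` the integrand is at least `4ⁿ` while the measure is at least `c 4⁻ⁿ`, so that part never drops
below `c` once `A n` lies in the domain. -/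
theorem setLIntegral_succMin_rpow_eq_top (μ : Measure UnimodularLattice) [IsProbabilityMeasure μ]
    [SMulInvariantMeasure SLTwo UnimodularLattice μ] {α : ℝ} (hα : 0 < α) :
    ∫⁻ L in {L | succMin 1 L < α}, ENNReal.ofReal (succMin 1 L ^ (-2 : ℝ)) ∂μ = ∞ := by
  by_contra hfin
  set A : ℕ → Set UnimodularLattice := fun n => {L | succMin 1 L < (1 / 2) ^ n} with hA
  have hAm : ∀ n, MeasurableSet (A n) := fun n =>
    measurableSet_lt measurable_succMin_one measurable_const
  obtain ⟨c, hc0, hc⟩ := exists_le_four_pow_mul_measure μ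
  have hlim : Tendsto (fun n => μ (A n)) atTop (𝓝 0) := by
    have hb : ∀ n, μ (A n) ≤ 16 * (4⁻¹ : ℝ≥0∞) ^ n := by
      intro n
      have h := four_pow_mul_measure_le μ n
      rw [← ENNReal.inv_pow, ← div_eq_mul_inv,
        ENNReal.le_div_iff_mul_le (Or.inl (by simp)) (Or.inl (by simp)), mul_comm]
      exact h
    have h0 : Tendsto (fun n : ℕ => 16 * (4⁻¹ : ℝ≥0∞) ^ n) atTop (𝓝 0) := by
      have := ENNReal.Tendsto.const_mul (a := 16) (ENNReal.tendsto_pow_atTop_nhds_zero_of_lt_one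
        (r := 4⁻¹) (by simp)) (Or.inr (by simp))
      simpa using this
    exact tendsto_of_tendsto_of_tendsto_of_le_of_le tendsto_const_nhds h0 (fun _ => zero_le) hb
  have hlim' : Tendsto (fun n => (μ.restrict {L | succMin 1 L < α}) (A n)) atTop (𝓝 0) :=
    tendsto_of_tendsto_of_tendsto_of_le_of_le tendsto_const_nhds hlim (fun _ => zero_le)
      fun n => Measure.restrict_apply_le _ _
  have hz := tendsto_setLIntegral_zero hfin hlim'
  have hev : ∀ᶠ n : ℕ in atTop, c ≤ ∫⁻ L in A n, ENNReal.ofReal (succMin 1 L ^ (-2 : ℝ))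
      ∂(μ.restrict {L | succMin 1 L < α}) := by
    have hsmall : ∀ᶠ n : ℕ in atTop, (1 / 2 : ℝ) ^ n < α :=
      (tendsto_pow_atTop_nhds_zero_of_lt_one (by norm_num) (by norm_num)).eventually_lt_const hα
    filter_upwards [hsmall] with n hn
    rw [Measure.restrict_restrict (hAm n), Set.inter_eq_left.2 (by
      intro L hL
      exact lt_trans hL hn)]
    refine (hc n).trans ?_
    rw [← setLIntegral_const]
    refine setLIntegral_mono' (hAm n) fun L hL => ?_
    have hp := succMin_one_pos L
    have hL' : succMin 1 L < (1 / 2) ^ n := hL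
    rw [show (4 : ℝ≥0∞) ^ n = ENNReal.ofReal (4 ^ n) by
      rw [ENNReal.ofReal_pow (by norm_num)]; norm_num]
    refine ENNReal.ofReal_le_ofReal ?_
    calc (4 : ℝ) ^ n = ((1 / 2 : ℝ) ^ n) ^ (-2 : ℝ) := by
          rw [Real.rpow_neg (by positivity), Real.rpow_two, ← pow_mul, mul_comm, pow_mul, ← inv_pow]
          norm_num
      _ ≤ _ := Real.rpow_le_rpow_of_nonpos hp hL'.le (by norm_num)
  exact hc0 (le_antisymm (ge_of_tendsto hz hev) zero_le)

end LatticeWeights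

/-! ### Random series of independent subgaussian variables -/

namespace LatticeWeights

section RandomSeries

variable {Ω ι : Type*} {mΩ : MeasurableSpace Ω} {P : Measure Ω}

/-- The pointwise bound `|y|^p ≤ (pw)^p max(e^(y/w), e^(-y/w))` reduces moments to exponential
moments at `±1/w`, which are at most `e^(1/2)` since `v ≤ w²`. -/
theorem lintegral_rpow_le_of_hasSubgaussianMGF [IsProbabilityMeasure P] {p : ℝ} (hp : 0 ≤ p)
    {Y : Ω → ℝ} {v : ℝ≥0} (hY : HasSubgaussianMGF Y v P) {w : ℝ} (hw : 0 < w) (hvw : v ≤ w ^ 2) :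
    ∫⁻ ω, ENNReal.ofReal (|Y ω| ^ p) ∂P ≤
      ENNReal.ofReal (2 * p ^ p * Real.exp (1 / 2)) * ENNReal.ofReal (w ^ p) := by
  have hexp : ∀ t : ℝ, |t| ≤ 1 / w → ∫⁻ ω, ENNReal.ofReal (Real.exp (t * Y ω)) ∂P ≤
      ENNReal.ofReal (Real.exp (1 / 2)) := by
    intro t ht
    rw [← ofReal_integral_eq_lintegral_ofReal (hY.integrable_exp_mul t)
      (Eventually.of_forall fun ω => (Real.exp_pos _).le)]
    refine ENNReal.ofReal_le_ofReal ((hY.mgf_le t).trans (Real.exp_le_exp.2 ?_))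
    have h1 : t ^ 2 ≤ (1 / w) ^ 2 := sq_le_sq' (abs_le.1 ht).1 (abs_le.1 ht).2
    have h2 : v * t ^ 2 ≤ w ^ 2 * (1 / w) ^ 2 :=
      mul_le_mul hvw h1 (sq_nonneg t) (sq_nonneg w)
    have h3 : w ^ 2 * (1 / w) ^ 2 = 1 := by field_simp
    linarith
  have hpt : ∀ ω, ENNReal.ofReal (|Y ω| ^ p) ≤ ENNReal.ofReal (p ^ p * w ^ p) *
      (ENNReal.ofReal (Real.exp (1 / w * Y ω)) + ENNReal.ofReal (Real.exp (-(1 / w) * Y ω))) := by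
    intro ω
    rw [← ENNReal.ofReal_add (Real.exp_pos _).le (Real.exp_pos _).le,
      ← ENNReal.ofReal_mul (by positivity)]
    refine ENNReal.ofReal_le_ofReal ((rpow_abs_le_mul_max_exp_of_pos (Y ω) hp
      (one_div_pos.2 hw)).trans ?_)
    have e : p / (1 / w) = p * w := by field_simp
    rw [e, Real.mul_rpow hp hw.le]
    gcongr
    exact max_le_add_of_nonneg (Real.exp_pos _).le (Real.exp_pos _).le
  have hm : ∀ t : ℝ, AEMeasurable (fun ω => ENNReal.ofReal (Real.exp (t * Y ω))) P :=
    fun t => (hY.integrable_exp_mul t).1.aemeasurable.ennreal_ofReal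
  calc ∫⁻ ω, ENNReal.ofReal (|Y ω| ^ p) ∂P
      ≤ ∫⁻ ω, ENNReal.ofReal (p ^ p * w ^ p) * (ENNReal.ofReal (Real.exp (1 / w * Y ω)) +
          ENNReal.ofReal (Real.exp (-(1 / w) * Y ω))) ∂P := lintegral_mono hpt
    _ = ENNReal.ofReal (p ^ p * w ^ p) * (∫⁻ ω, ENNReal.ofReal (Real.exp (1 / w * Y ω)) ∂P +
          ∫⁻ ω, ENNReal.ofReal (Real.exp (-(1 / w) * Y ω)) ∂P) := by
        rw [lintegral_const_mul' _ _ ENNReal.ofReal_ne_top, lintegral_add_left' (hm _)]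
    _ ≤ ENNReal.ofReal (p ^ p * w ^ p) * (ENNReal.ofReal (Real.exp (1 / 2)) +
          ENNReal.ofReal (Real.exp (1 / 2))) := by
        have ha : |1 / w| = 1 / w := abs_of_pos (one_div_pos.2 hw)
        gcongr
        · exact hexp _ ha.le
        · exact hexp _ (by rw [abs_neg, ha])
    _ = _ := by
        rw [← ENNReal.ofReal_add (Real.exp_pos _).le (Real.exp_pos _).le,
          ← ENNReal.ofReal_mul (by positivity), ← ENNReal.ofReal_mul (by positivity)]
        congr 1
        ring

theorem hasSubgaussianMGF_sum_mul {X : ι → Ω → ℝ} (hind : iIndepFun X P) {c : ℝ≥0}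
    (hsub : ∀ k, HasSubgaussianMGF (X k) c P) (a : ι → ℝ) (s : Finset ι) :
    HasSubgaussianMGF (fun ω => ∑ k ∈ s, a k * X k ω)
      (∑ k ∈ s, (a k ^ 2).toNNReal * c) P := by
  have hi : iIndepFun (fun k ω => a k * X k ω) P :=
    hind.comp (fun k x => a k * x) fun k => measurable_const_mul (a k)
  refine HasSubgaussianMGF.sum_of_iIndepFun hi fun k _ => ?_
  rw [Real.toNNReal_of_nonneg (sq_nonneg (a k))]
  exact (hsub k).const_mul (a k)

theorem lintegral_rpow_sum_le [IsProbabilityMeasure P] {X : ι → Ω → ℝ} (hind : iIndepFun X P)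
    {c : ℝ≥0} (hsub : ∀ k, HasSubgaussianMGF (X k) c P) (a : ι → ℝ) (s : Finset ι) {p : ℝ}
    (hp : 0 ≤ p) {w : ℝ} (hw : 0 < w) (haw : c * ∑ k ∈ s, a k ^ 2 ≤ w ^ 2) :
    ∫⁻ ω, ENNReal.ofReal (|∑ k ∈ s, a k * X k ω| ^ p) ∂P ≤
      ENNReal.ofReal (2 * p ^ p * Real.exp (1 / 2)) * ENNReal.ofReal (w ^ p) := by
  refine lintegral_rpow_le_of_hasSubgaussianMGF hp (hasSubgaussianMGF_sum_mul hind hsub a s) hw ?_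
  rw [← Finset.sum_mul, mul_comm]
  push_cast
  simpa only [Real.coe_toNNReal _ (sq_nonneg _)] using haw

theorem measurable_iSup_comap {X : ι → Ω → ℝ} (a : ι → ℝ) (s t : Finset ι) (hst : s ⊆ t) :
    Measurable[⨆ k ∈ (t : Set ι), MeasurableSpace.comap (X k) inferInstance]
      fun ω => ∑ k ∈ s, a k * X k ω := by
  refine Finset.measurable_fun_sum _ fun k hk => Measurable.const_mul ?_ _
  refine Measurable.mono (comap_measurable (X k)) ?_ le_rfl
  exact le_iSup₂_of_le k (hst hk) le_rfl

/-- Square-summable sums of independent centred subgaussian variables converge almost surely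
along any increasing sequence of finite sets. -/
theorem ae_exists_tendsto_sum [IsProbabilityMeasure P] {X : ι → Ω → ℝ}
    (hm : ∀ k, Measurable (X k)) (hind : iIndepFun X P) {c : ℝ≥0}
    (hsub : ∀ k, HasSubgaussianMGF (X k) c P) (hmean : ∀ k, ∫ ω, X k ω ∂P = 0) (a : ι → ℝ)
    {B : ℝ} (hB : ∀ s : Finset ι, ∑ k ∈ s, a k ^ 2 ≤ B) (F : ℕ → Finset ι) (hF : Monotone F) :
    ∀ᵐ ω ∂P, ∃ l, Tendsto (fun n => ∑ k ∈ F n, a k * X k ω) atTop (𝓝 l) := by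
  classical
  have hle : ∀ k, MeasurableSpace.comap (X k) inferInstance ≤ mΩ := fun k => (hm k).comap_le
  set 𝒢 : Filtration ℕ mΩ :=
    { seq := fun n => ⨆ k ∈ (F n : Set ι), MeasurableSpace.comap (X k) inferInstance
      mono' := fun m n hmn => biSup_mono fun k hk => hF hmn hk
      le' := fun n => iSup₂_le fun k _ => hle k } with h𝒢
  have hinteg : ∀ s : Finset ι, Integrable (fun ω => ∑ k ∈ s, a k * X k ω) P := fun s =>
    integrable_finsetSum _ fun k _ => (hsub k).integrable.const_mul _
  -- The increment uses only indices outside `F n`, so it is independent of the past and centred.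
  have hmart : Martingale (fun n ω => ∑ k ∈ F n, a k * X k ω) 𝒢 P := by
    refine martingale_of_condExp_sub_eq_zero_nat (fun n => ?_) (fun n => hinteg _) fun n => ?_
    · exact (measurable_iSup_comap a (F n) (F n) subset_rfl).stronglyMeasurable
    · have hdiff : ((fun ω => ∑ k ∈ F (n + 1), a k * X k ω) - fun ω => ∑ k ∈ F n, a k * X k ω) =
          fun ω => ∑ k ∈ F (n + 1) \ F n, a k * X k ω := by
        ext ω
        rw [Pi.sub_apply, ← Finset.sum_sdiff (hF n.le_succ), add_sub_cancel_right]
      rw [hdiff]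
      have hdisj : Disjoint ((F (n + 1) \ F n : Finset ι) : Set ι) (F n : Set ι) := by
        exact_mod_cast Finset.sdiff_disjoint
      have hindep := indep_iSup_of_disjoint hle hind hdisj
      refine (condExp_indep_eq (iSup₂_le fun k _ => hle k) (𝒢.le n)
        (measurable_iSup_comap a _ _ subset_rfl).stronglyMeasurable hindep).trans ?_
      refine Eventually.of_forall fun ω => ?_
      simp only [Pi.zero_apply]
      rw [integral_finsetSum _ fun k _ => (hsub k).integrable.const_mul _]
      exact Finset.sum_eq_zero fun k _ => by rw [integral_const_mul, hmean, mul_zero]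
  have hB0 : 0 ≤ B := by simpa using hB ∅
  -- The added `1` keeps `w` positive when `c * B = 0`. The moment bound with `p = 1` then bounds
  -- the martingale in `L¹`, as Doob's theorem requires.
  set w : ℝ := Real.sqrt (c * B + 1) with hw
  have hwsq : w ^ 2 = c * B + 1 := Real.sq_sqrt (by positivity)
  have hbdd : ∀ n, eLpNorm (fun ω => ∑ k ∈ F n, a k * X k ω) 1 P ≤
      ((2 * (1 : ℝ) ^ (1 : ℝ) * Real.exp (1 / 2)).toNNReal * (w ^ (1 : ℝ)).toNNReal : ℝ≥0) := by
    intro n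
    have h := lintegral_rpow_sum_le hind hsub a (F n) (p := 1) zero_le_one
      (w := w) (Real.sqrt_pos.2 (by positivity)) (by
        rw [hwsq]
        have : (c : ℝ) * ∑ k ∈ F n, a k ^ 2 ≤ c * B :=
          mul_le_mul_of_nonneg_left (hB (F n)) c.coe_nonneg
        linarith)
    rw [eLpNorm_one_eq_lintegral_enorm, ENNReal.coe_mul]
    refine le_trans (le_of_eq ?_) h
    refine lintegral_congr fun ω => ?_
    rw [Real.rpow_one, Real.enorm_eq_ofReal_abs]
  filter_upwards [hmart.submartingale.ae_tendsto_limitProcess hbdd] with ω hω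
  exact ⟨_, hω⟩

/-- Almost sure convergence of a random series whose terms are ordered by the size of `N`. -/
theorem ae_exists_tendsto_sum_sublevel [IsProbabilityMeasure P] [Infinite ι] {X : ι → Ω → ℝ}
    (hm : ∀ k, Measurable (X k)) (hind : iIndepFun X P) {c : ℝ≥0}
    (hsub : ∀ k, HasSubgaussianMGF (X k) c P) (hmean : ∀ k, ∫ ω, X k ω ∂P = 0) (a : ι → ℝ)
    {B : ℝ} (hB : ∀ s : Finset ι, ∑ k ∈ s, a k ^ 2 ≤ B) {N : ι → ℝ}
    (hN : ∀ A, {k | N k ≤ A}.Finite) :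
    ∀ᵐ ω ∂P, ∃ l, Tendsto (fun A : ℝ => ∑ k ∈ (hN A).toFinset, a k * X k ω) atTop (𝓝 l) := by
  have hlt : ∀ k, {j | N j < N k}.Finite := fun k => (hN (N k)).subset fun j (hj : N j < N k) => hj.le
  -- Indices with equal `N` share a rank, so every real sublevel set of `N` is a sublevel set of the
  -- rank. Convergence along one integer sequence then covers all real `A` with a single null set.
  set rank : ι → ℕ := fun k => {j | N j < N k}.ncard with hrank
  have hset : ∀ A, {k | rank k < {k | N k ≤ A}.ncard} = {k | N k ≤ A} := by
    intro A
    ext k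
    simp only [Set.mem_ofPred_eq]
    constructor
    · intro h
      by_contra hk
      push Not at hk
      refine absurd (Set.ncard_le_ncard (s := {j | N j ≤ A}) (t := {j | N j < N k})
        (fun j (hj : N j ≤ A) => hj.trans_lt hk) (hlt k)) h.not_ge
    · intro hk
      refine Set.ncard_lt_ncard ⟨fun j (hj : N j < N k) => (hj.trans_le hk).le, fun hsub => ?_⟩
        (hN A)
      exact lt_irrefl (N k) (hsub hk)
  have hcard : Tendsto (fun A => {k | N k ≤ A}.ncard) atTop atTop := by
    refine tendsto_atTop_atTop_of_monotone
      (fun A B hAB => Set.ncard_le_ncard (fun k (hk : N k ≤ A) => hk.trans hAB) (hN B)) fun n => ?_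
    obtain ⟨s, hs⟩ := Infinite.exists_subset_card_eq ι n
    obtain ⟨A, hA⟩ := (s.image N).bddAbove
    refine ⟨A, ?_⟩
    rw [← hs, ← Set.ncard_coe_finset]
    refine Set.ncard_le_ncard (fun k hk => hA ?_) (hN A)
    simp only [Finset.coe_image]
    exact ⟨k, hk, rfl⟩
  have hfin : ∀ n, {k | rank k < n}.Finite := by
    intro n
    obtain ⟨A, hA⟩ := (hcard.eventually_ge_atTop n).exists
    refine (hN A).subset ?_
    rw [← hset A]
    exact fun k (hk : rank k < n) => hk.trans_le hA
  have hmono : Monotone fun n => (hfin n).toFinset := by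
    intro m n hmn k hk
    simp only [Set.Finite.mem_toFinset, Set.mem_ofPred_eq] at hk ⊢
    exact hk.trans_le hmn
  filter_upwards [ae_exists_tendsto_sum hm hind hsub hmean a hB _ hmono] with ω ⟨l, hl⟩
  refine ⟨l, (hl.comp hcard).congr fun A => ?_⟩
  simp only [Function.comp_apply]
  congr 1
  ext k
  simp only [Set.Finite.mem_toFinset]
  rw [hset A]

end RandomSeries

/-- Independent, centred, uniformly subgaussian coordinates whose joint law is invariant under
changes of signs. -/
structure IsSymmetricNoise {ι : Type*} (Q : Measure (ι → ℝ)) : Prop where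
  indep : iIndepFun (fun k (z : ι → ℝ) => z k) Q
  subgaussian : ∃ c : ℝ≥0, ∀ k, HasSubgaussianMGF (fun z : ι → ℝ => z k) c Q
  mean : ∀ k, ∫ z, z k ∂Q = 0
  flip : ∀ ε : ι → ℝ, (∀ k, ε k = 1 ∨ ε k = -1) → MeasurePreserving (fun z k => ε k * z k) Q Q

/-- Moving to the joint law lets sign changes act on the probability space itself. That law is a
product of symmetric marginals, hence invariant; Hoeffding's lemma turns compact support into a
subgaussian bound, and identical distribution makes the constant uniform. -/
theorem isSymmetricNoise_map {Ω ι : Type*} [MeasurableSpace Ω] {P : Measure Ω}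
    [IsProbabilityMeasure P] {Z : ι → Ω → ℝ} (hZ : ∀ k, Measurable (Z k))
    (hindep : iIndepFun Z P) (hident : ∀ k l, IdentDistrib (Z k) (Z l) P P)
    (hsymm : ∀ k, P.map (Z k) = P.map fun ω => -Z k ω)
    (hsupp : ∀ k, ∃ K : Set ℝ, IsCompact K ∧ ∀ᵐ ω ∂P, Z k ω ∈ K) :
    IsSymmetricNoise (P.map fun ω k => Z k ω) := by
  have hZm : Measurable fun ω k => Z k ω := measurable_pi_iff.2 hZ
  have hQ := hindep.map_fun_eq_infinitePi_map hZ
  have hprob : ∀ k, IsProbabilityMeasure (P.map (Z k)) := fun k =>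
    Measure.isProbabilityMeasure_map (hZ k).aemeasurable
  have hprobQ : IsProbabilityMeasure (P.map fun ω k => Z k ω) :=
    Measure.isProbabilityMeasure_map hZm.aemeasurable
  have heval : ∀ k, (P.map fun ω k => Z k ω).map (fun z : ι → ℝ => z k) = P.map (Z k) := fun k =>
    Measure.map_map (measurable_pi_apply k) hZm
  have hmean : ∀ k, ∫ ω, Z k ω ∂P = 0 := by
    intro k
    have h1 : ∫ x, x ∂(P.map (Z k)) = ∫ ω, Z k ω ∂P :=
      integral_map (hZ k).aemeasurable aestronglyMeasurable_id
    have h2 : ∫ x, x ∂(P.map fun ω => -Z k ω) = ∫ ω, -Z k ω ∂P :=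
      integral_map (hZ k).neg.aemeasurable aestronglyMeasurable_id
    rw [← hsymm k, h1, integral_neg] at h2
    linarith
  refine ⟨?_, ?_, ?_, ?_⟩
  · rw [iIndepFun_iff_map_fun_eq_infinitePi_map measurable_pi_apply]
    simp only [heval]
    exact Measure.map_id.trans hQ
  · rcases isEmpty_or_nonempty ι with hι | ⟨⟨k₀⟩⟩
    · exact ⟨0, fun k => isEmptyElim k⟩
    · obtain ⟨K, hK, hKae⟩ := hsupp k₀
      obtain ⟨M, hM⟩ := hK.isBounded.exists_norm_le
      have hsub : HasSubgaussianMGF (Z k₀) ((‖M - -M‖₊ / 2) ^ 2) P := by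
        refine hasSubgaussianMGF_of_mem_Icc_of_integral_eq_zero (hZ k₀).aemeasurable ?_ (hmean k₀)
        filter_upwards [hKae] with ω hω
        exact abs_le.1 (hM _ hω)
      refine ⟨_, fun k => (hsub.congr_identDistrib (hident k₀ k)).congr_identDistrib ?_⟩
      exact ⟨(hZ k).aemeasurable, (measurable_pi_apply k).aemeasurable, (heval k).symm⟩
  · intro k
    rw [integral_map hZm.aemeasurable (measurable_pi_apply k).aestronglyMeasurable]
    exact hmean k
  · intro ε hε
    refine ⟨measurable_pi_iff.2 fun k => (measurable_pi_apply k).const_mul _, ?_⟩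
    rw [hQ, Measure.infinitePi_map_pi (μ := fun k => P.map (Z k))
      (f := fun k x => ε k * x) fun k => measurable_const_mul (ε k)]
    congr 1
    ext1 k
    rw [Measure.map_map (measurable_const_mul _) (hZ k)]
    rcases hε k with h | h
    · simp only [h, one_mul]
      rfl
    · simp only [h, neg_one_mul, hsymm k]
      rw [← hsymm k]
      exact (hsymm k).symm

end LatticeWeights

/-! ### The limit of the modified Siegel transform and its conditional moments -/

namespace LatticeWeights

open UnimodularLattice

instance : Infinite PrimeIndex :=
  Infinite.of_injective (fun n : ℕ => (⟨(1, n), by simp⟩ : PrimeIndex)) fun n m h => by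
    have := congrArg (fun k : PrimeIndex => k.1.2) h
    simpa using this

/-- The coefficient of `Z_k` in the modified Siegel transform. -/
noncomputable def weight (L : UnimodularLattice) (k : PrimeIndex) : ℝ :=
  (indexNorm L k ^ (3 / 2 : ℝ))⁻¹

theorem modifiedSiegel_eq_sum {Ω : Type*} (Z : PrimeIndex → Ω → ℝ) {L : UnimodularLattice}
    (hL : IsGeneric L) (A : ℝ) (ω : Ω) : modifiedSiegel Z A (ω, L) =
      ∑ k ∈ (hL.finite_primeIndexUpTo A).toFinset, weight L k * Z k ω := by
  rw [modifiedSiegel, finsum_mem_eq_finite_toFinset_sum _ (hL.finite_primeIndexUpTo A)]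
  exact Finset.sum_congr rfl fun k _ => by rw [weight, div_eq_inv_mul]

/-- The modified Siegel transform, as a function of the weights, set to zero on non-generic
lattices. -/
noncomputable def truncatedSum (A : ℝ) (x : (PrimeIndex → ℝ) × UnimodularLattice) : ℝ :=
  ∑' k, {x : (PrimeIndex → ℝ) × UnimodularLattice | IsGeneric x.2 ∧ indexNorm x.2 k ≤ A}.indicator
    (fun x => weight x.2 k * x.1 k) x

theorem truncatedSum_eq_sum {L : UnimodularLattice} (hL : IsGeneric L) (A : ℝ)
    (z : PrimeIndex → ℝ) : truncatedSum A (z, L) =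
      ∑ k ∈ (hL.finite_primeIndexUpTo A).toFinset, weight L k * z k := by
  rw [truncatedSum, tsum_eq_sum (s := (hL.finite_primeIndexUpTo A).toFinset)]
  · refine Finset.sum_congr rfl fun k hk => Set.indicator_of_mem ?_ _
    exact ⟨hL, (Set.Finite.mem_toFinset (hL.finite_primeIndexUpTo A)).1 hk⟩
  · intro k hk
    refine Set.indicator_of_notMem (fun h => hk ?_) _
    exact (Set.Finite.mem_toFinset (hL.finite_primeIndexUpTo A)).2 h.2

theorem measurable_truncatedSum (A : ℝ) : Measurable (truncatedSum A) := by
  refine Measurable.tsum fun k => Measurable.indicator ?_ ?_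
  · exact (((measurable_indexNorm k).pow_const _).inv.comp measurable_snd).mul
      ((measurable_pi_apply k).comp measurable_fst)
  · exact (measurable_snd measurableSet_isGeneric).inter
      (measurable_snd (measurableSet_le (measurable_indexNorm k) measurable_const))

/-- The truncated sums have a limit along the rationals. -/
def HasLimit (x : (PrimeIndex → ℝ) × UnimodularLattice) : Prop :=
  ∃ l, Tendsto (fun q : ℚ => truncatedSum q x) atTop (𝓝 l)

/-- The limit of the truncated sums. -/
noncomputable def limitSum (x : (PrimeIndex → ℝ) × UnimodularLattice) : ℝ :=
  limUnder (atTop : Filter ℚ) fun q => truncatedSum q x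

theorem measurable_limitSum : Measurable limitSum :=
  (StronglyMeasurable.limUnder fun q : ℚ => (measurable_truncatedSum q).stronglyMeasurable).measurable

theorem measurableSet_hasLimit : MeasurableSet {x | HasLimit x} :=
  MeasureTheory.measurableSet_exists_tendsto fun q : ℚ => measurable_truncatedSum q

/-- Only finitely many index norms lie in `(A, A + 1]`, so the sum is constant just to the right of
`A`. The limit along rationals, which is visibly measurable, therefore governs the limit along
reals. -/
theorem exists_rat_truncatedSum_eq {L : UnimodularLattice} (hL : IsGeneric L) (A : ℝ)
    (z : PrimeIndex → ℝ) : ∃ q : ℚ, A ≤ q ∧ truncatedSum q (z, L) = truncatedSum A (z, L) := by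
  have hfin : {k | A < indexNorm L k ∧ indexNorm L k ≤ A + 1}.Finite :=
    (hL.finite_primeIndexUpTo (A + 1)).subset fun k hk => hk.2
  have hev : ∀ᶠ x in 𝓝[>] A, x < A + 1 ∧ ∀ k ∈ {k | A < indexNorm L k ∧ indexNorm L k ≤ A + 1},
      x < indexNorm L k := by
    refine Filter.Eventually.and ?_ ((Set.Finite.eventually_all hfin).2 fun k hk => ?_)
    · exact (eventually_lt_nhds (lt_add_one A)).filter_mono nhdsWithin_le_nhds
    · exact (eventually_lt_nhds hk.1).filter_mono nhdsWithin_le_nhds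
  obtain ⟨u, hu, hsub⟩ := (mem_nhdsGT_iff_exists_Ioo_subset).1 hev
  obtain ⟨q, hq1, hq2⟩ := exists_rat_btwn (show A < u from hu)
  obtain ⟨h1, h2⟩ := hsub ⟨hq1, hq2⟩
  refine ⟨q, hq1.le, ?_⟩
  rw [truncatedSum_eq_sum hL, truncatedSum_eq_sum hL]
  congr 1
  ext k
  simp only [Set.Finite.mem_toFinset, primeIndexUpTo, Set.mem_ofPred_eq]
  refine ⟨fun h => ?_, fun h => h.trans hq1.le⟩
  by_contra hk
  exact absurd (h2 k ⟨not_le.1 hk, h.trans h1.le⟩) h.not_gt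

theorem HasLimit.tendsto_rat {x : (PrimeIndex → ℝ) × UnimodularLattice} (h : HasLimit x) :
    Tendsto (fun q : ℚ => truncatedSum q x) atTop (𝓝 (limitSum x)) :=
  tendsto_nhds_limUnder h

theorem HasLimit.tendsto {L : UnimodularLattice} (hL : IsGeneric L) {z : PrimeIndex → ℝ}
    (h : HasLimit (z, L)) :
    Tendsto (fun A : ℝ => truncatedSum A (z, L)) atTop (𝓝 (limitSum (z, L))) := by
  have hq := h.tendsto_rat
  rw [Metric.tendsto_atTop] at hq ⊢
  intro ε hε
  obtain ⟨N, hN⟩ := hq ε hε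
  refine ⟨N, fun A hA => ?_⟩
  obtain ⟨q, hq1, hq2⟩ := exists_rat_truncatedSum_eq hL A z
  rw [← hq2]
  exact hN q (by exact_mod_cast hA.trans hq1)

/-- The constant in the bound for the sum of the squares of the coefficients. -/
noncomputable def weightConst : ℝ := 8 * ∑' x : Fin 2 → ℤ, ‖x‖ ^ (-3 : ℝ)

theorem weightConst_nonneg : 0 ≤ weightConst :=
  mul_nonneg (by norm_num) (tsum_nonneg fun x => Real.rpow_nonneg (norm_nonneg x) _)

/-- Squared weights are inverse cubes of index norms, comparable from above to `‖L‖₁⁻³ |k|⁻³`; the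
exponent `3` exceeds the rank `2`, so the Eisenstein-type series converges. The `8` is the cube of
the `2` in `IsGeneric.le_indexNorm`. -/
theorem IsGeneric.sum_weight_sq_le {L : UnimodularLattice} (hL : IsGeneric L)
    (s : Finset PrimeIndex) :
    ∑ k ∈ s, weight L k ^ 2 ≤ weightConst * (succMin 1 L ^ (-(3 / 2) : ℝ)) ^ 2 := by
  have hp := succMin_one_pos L
  have hterm : ∀ k, weight L k ^ 2 ≤
      8 * (succMin 1 L ^ (-(3 / 2) : ℝ)) ^ 2 * ‖k.vec‖ ^ (-3 : ℝ) := by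
    intro k
    have hN := hL.indexNorm_pos k
    have hk := norm_pos_iff.2 k.vec_ne_zero
    have hle : succMin 1 L * ‖k.vec‖ / 2 ≤ indexNorm L k := by
      have := hL.le_indexNorm k
      linarith
    have e1 : weight L k ^ 2 = indexNorm L k ^ (-3 : ℝ) := by
      rw [weight, ← Real.rpow_neg hN.le, ← Real.rpow_natCast, ← Real.rpow_mul hN.le]
      norm_num
    have e2 : (succMin 1 L ^ (-(3 / 2) : ℝ)) ^ 2 = succMin 1 L ^ (-3 : ℝ) := by
      rw [← Real.rpow_natCast, ← Real.rpow_mul hp.le]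
      norm_num
    rw [e1, e2]
    calc indexNorm L k ^ (-3 : ℝ) ≤ (succMin 1 L * ‖k.vec‖ / 2) ^ (-3 : ℝ) :=
          Real.rpow_le_rpow_of_nonpos (by positivity) hle (by norm_num)
      _ = 8 * succMin 1 L ^ (-3 : ℝ) * ‖k.vec‖ ^ (-3 : ℝ) := by
          rw [Real.div_rpow (by positivity) (by norm_num), Real.mul_rpow hp.le hk.le,
            Real.rpow_neg (by norm_num : (0 : ℝ) ≤ 2)]
          norm_num
          ring
  have hsum : Summable fun x : Fin 2 → ℤ => ‖x‖ ^ (-3 : ℝ) :=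
    EisensteinSeries.summable_one_div_norm_rpow (by norm_num)
  calc ∑ k ∈ s, weight L k ^ 2
      ≤ ∑ k ∈ s, 8 * (succMin 1 L ^ (-(3 / 2) : ℝ)) ^ 2 * ‖k.vec‖ ^ (-3 : ℝ) :=
        Finset.sum_le_sum fun k _ => hterm k
    _ = 8 * (succMin 1 L ^ (-(3 / 2) : ℝ)) ^ 2 * ∑ k ∈ s, ‖k.vec‖ ^ (-3 : ℝ) := by
        rw [Finset.mul_sum]
    _ ≤ 8 * (succMin 1 L ^ (-(3 / 2) : ℝ)) ^ 2 * ∑' x : Fin 2 → ℤ, ‖x‖ ^ (-3 : ℝ) := by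
        gcongr
        refine (Finset.sum_map s ⟨PrimeIndex.vec, PrimeIndex.vec_injective⟩
          (fun x => ‖x‖ ^ (-3 : ℝ))).symm.trans_le ?_
        exact hsum.sum_le_tsum _ fun x _ => Real.rpow_nonneg (norm_nonneg x) _
    _ = _ := by rw [weightConst]; ring

section Noise

variable {Q : Measure (PrimeIndex → ℝ)} [IsProbabilityMeasure Q]

theorem ae_hasLimit (hQ : IsSymmetricNoise Q) {L : UnimodularLattice} (hL : IsGeneric L) :
    ∀ᵐ z ∂Q, HasLimit (z, L) := by
  obtain ⟨c, hc⟩ := hQ.subgaussian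
  filter_upwards [ae_exists_tendsto_sum_sublevel measurable_pi_apply hQ.indep hc hQ.mean (weight L)
    hL.sum_weight_sq_le hL.finite_primeIndexUpTo] with z ⟨l, hl⟩
  refine ⟨l, ?_⟩
  have hcast : Tendsto (fun q : ℚ => (q : ℝ)) atTop atTop := tendsto_ratCast_atTop_iff.2 tendsto_id
  exact (hl.comp hcast).congr fun q => (truncatedSum_eq_sum hL q z).symm

theorem ae_prod_hasLimit (hQ : IsSymmetricNoise Q) {μ : Measure UnimodularLattice} [SFinite μ]
    (hμ : ∀ᵐ L ∂μ, IsGeneric L) : ∀ᵐ x ∂(Q.prod μ), IsGeneric x.2 ∧ HasLimit x := by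
  have hm : MeasurableSet {x : (PrimeIndex → ℝ) × UnimodularLattice | IsGeneric x.2 ∧ HasLimit x} :=
    (measurable_snd measurableSet_isGeneric).inter measurableSet_hasLimit
  rw [ae_iff, ← Set.compl_ofPred, Measure.prod_apply_symm hm.compl,
    lintegral_eq_zero_iff (measurable_measure_prodMk_right hm.compl)]
  filter_upwards [hμ] with L hL
  refine measure_mono_null ?_ (ae_iff.1 (ae_hasLimit hQ hL))
  intro z hz h
  exact hz ⟨hL, h⟩

/-- Moments of the limit given the lattice. -/
theorem exists_lintegral_limitSum_rpow_le (hQ : IsSymmetricNoise Q) {p : ℝ} (hp : 0 ≤ p) :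
    ∃ C : ℝ≥0∞, C ≠ ∞ ∧ ∀ L, IsGeneric L →
      ∫⁻ z, ENNReal.ofReal (|limitSum (z, L)| ^ p) ∂Q ≤
        C * ENNReal.ofReal (succMin 1 L ^ (-(3 / 2 * p))) := by
  obtain ⟨c, hc⟩ := hQ.subgaussian
  have hK := weightConst_nonneg
  set b : ℝ := Real.sqrt (c * weightConst + 1)
  have hb : 0 < b := Real.sqrt_pos.2 (by positivity)
  have hb2 : b ^ 2 = c * weightConst + 1 := Real.sq_sqrt (by positivity)
  refine ⟨ENNReal.ofReal (2 * p ^ p * Real.exp (1 / 2)) * ENNReal.ofReal (b ^ p),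
    ENNReal.mul_ne_top ENNReal.ofReal_ne_top ENNReal.ofReal_ne_top, fun L hL => ?_⟩
  have hpos := succMin_one_pos L
  -- The scale `w` dominates the subgaussian parameter of every partial sum, so the moment bound is
  -- uniform in the truncation and passes to the limit by Fatou.
  set w : ℝ := b * succMin 1 L ^ (-(3 / 2) : ℝ) with hw
  have hwpos : 0 < w := mul_pos hb (Real.rpow_pos_of_pos hpos _)
  have hwp : w ^ p = b ^ p * succMin 1 L ^ (-(3 / 2 * p)) := by
    rw [hw, Real.mul_rpow hb.le (Real.rpow_pos_of_pos hpos _).le, ← Real.rpow_mul hpos.le]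
    ring_nf
  rw [mul_assoc, ← ENNReal.ofReal_mul (by positivity), ← hwp]
  have hbound : ∀ n : ℕ, ∫⁻ z, ENNReal.ofReal (|truncatedSum n (z, L)| ^ p) ∂Q ≤
      ENNReal.ofReal (2 * p ^ p * Real.exp (1 / 2)) * ENNReal.ofReal (w ^ p) := by
    intro n
    simp only [truncatedSum_eq_sum hL]
    refine lintegral_rpow_sum_le hQ.indep hc (weight L) _ hp hwpos ?_
    rw [hw, mul_pow, hb2]
    have h1 := mul_le_mul_of_nonneg_left
      (hL.sum_weight_sq_le (hL.finite_primeIndexUpTo n).toFinset) c.coe_nonneg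
    nlinarith [sq_nonneg (succMin 1 L ^ (-(3 / 2) : ℝ))]
  have hmeas : ∀ n : ℕ, Measurable fun z => ENNReal.ofReal (|truncatedSum n (z, L)| ^ p) := by
    intro n
    have h : Measurable fun z => truncatedSum n (z, L) :=
      (measurable_truncatedSum n).comp measurable_prodMk_right
    exact (h.abs.pow_const p).ennreal_ofReal
  calc ∫⁻ z, ENNReal.ofReal (|limitSum (z, L)| ^ p) ∂Q
      = ∫⁻ z, liminf (fun n : ℕ => ENNReal.ofReal (|truncatedSum n (z, L)| ^ p)) atTop ∂Q := by
        refine lintegral_congr_ae ?_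
        filter_upwards [ae_hasLimit hQ hL] with z hz
        have h1 := (HasLimit.tendsto hL hz).comp tendsto_natCast_atTop_atTop
        exact ((ENNReal.continuous_ofReal.tendsto _).comp
          (h1.abs.rpow_const (Or.inr hp))).liminf_eq.symm
    _ ≤ liminf (fun n : ℕ => ∫⁻ z, ENNReal.ofReal (|truncatedSum n (z, L)| ^ p) ∂Q) atTop :=
        lintegral_liminf_le hmeas
    _ ≤ _ := liminf_le_of_le (by isBoundedDefault) fun b hb => by
        obtain ⟨n, hn⟩ := hb.exists
        exact hn.trans (hbound n)

open Classical in
/-- Lower bound for the moments of the limit given the lattice. -/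
theorem lintegral_first_rpow_mul_le (hQ : IsSymmetricNoise Q) {p : ℝ} (hp : 0 ≤ p)
    {L : UnimodularLattice} (hL : IsGeneric L) :
    (∫⁻ z, ENNReal.ofReal (|z PrimeIndex.first| ^ p) ∂Q) *
        ENNReal.ofReal (succMin 1 L ^ (-(3 / 2 * p))) ≤
      2 * ∫⁻ z, ENNReal.ofReal (|limitSum (z, L)| ^ p) ∂Q := by
  -- This flip cancels every term but that of the shortest vector when the two sums are added.
  set ε : PrimeIndex → ℝ := fun k => if k = PrimeIndex.first then 1 else -1 with hε
  have hflip : MeasurePreserving (fun (z : PrimeIndex → ℝ) k => ε k * z k) Q Q :=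
    hQ.flip ε fun k => by
      by_cases h : k = PrimeIndex.first
      · exact Or.inl (if_pos h)
      · exact Or.inr (if_neg h)
  have hpos := succMin_one_pos L
  have hmeas : Measurable fun z => ENNReal.ofReal (|limitSum (z, L)| ^ p) := by
    have h : Measurable fun z => limitSum (z, L) := measurable_limitSum.comp measurable_prodMk_right
    exact (h.abs.pow_const p).ennreal_ofReal
  have hadd : ∀ z, HasLimit (z, L) → HasLimit (fun k => ε k * z k, L) →
      limitSum (z, L) + limitSum (fun k => ε k * z k, L) =
        2 * (weight L PrimeIndex.first * z PrimeIndex.first) := by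
    intro z h1 h2
    refine tendsto_nhds_unique ((HasLimit.tendsto hL h1).add (HasLimit.tendsto hL h2)) ?_
    refine tendsto_const_nhds.congr' ?_
    filter_upwards [eventually_ge_atTop (indexNorm L PrimeIndex.first)] with A hA
    rw [truncatedSum_eq_sum hL, truncatedSum_eq_sum hL, ← Finset.sum_add_distrib,
      Finset.sum_eq_single PrimeIndex.first]
    · simp only [hε, if_true]
      ring
    · intro k _ hk
      simp only [hε, if_neg hk]
      ring
    · intro h
      exact absurd ((Set.Finite.mem_toFinset (hL.finite_primeIndexUpTo A)).2 hA) h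
  have hw : weight L PrimeIndex.first = succMin 1 L ^ (-(3 / 2) : ℝ) := by
    rw [weight, hL.indexNorm_first, Real.rpow_neg hpos.le]
  have hpt : ∀ᵐ z ∂Q, ENNReal.ofReal (|z PrimeIndex.first| ^ p) *
      ENNReal.ofReal (succMin 1 L ^ (-(3 / 2 * p))) ≤ ENNReal.ofReal (|limitSum (z, L)| ^ p) +
        ENNReal.ofReal (|limitSum (fun k => ε k * z k, L)| ^ p) := by
    have h1 := ae_hasLimit hQ hL
    filter_upwards [h1, hflip.quasiMeasurePreserving.ae h1] with z hz hz'
    have e := hadd z hz hz'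
    rw [← ENNReal.ofReal_mul (by positivity), ← ENNReal.ofReal_add (by positivity) (by positivity)]
    refine ENNReal.ofReal_le_ofReal ?_
    set x := limitSum (z, L)
    set y := limitSum (fun k => ε k * z k, L)
    -- One of the two limits is at least half their sum in absolute value; both have the same law,
    -- whence the factor `2` in the conclusion.
    have hmax : |z PrimeIndex.first| * succMin 1 L ^ (-(3 / 2) : ℝ) ≤ max |x| |y| := by
      have e' : |z PrimeIndex.first| * succMin 1 L ^ (-(3 / 2) : ℝ) = |x + y| / 2 := by
        rw [e, hw, abs_mul, abs_mul, abs_two, abs_of_pos (Real.rpow_pos_of_pos hpos _)]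
        ring
      rw [e']
      have := abs_add_le x y
      have := le_max_left |x| |y|
      have := le_max_right |x| |y|
      linarith
    have e2 : |z PrimeIndex.first| ^ p * succMin 1 L ^ (-(3 / 2 * p)) =
        (|z PrimeIndex.first| * succMin 1 L ^ (-(3 / 2) : ℝ)) ^ p := by
      rw [Real.mul_rpow (abs_nonneg _) (by positivity), ← Real.rpow_mul hpos.le]
      ring_nf
    rw [e2]
    refine (Real.rpow_le_rpow (by positivity) hmax hp).trans ?_
    have hx : 0 ≤ |x| ^ p := by positivity
    have hy : 0 ≤ |y| ^ p := by positivity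
    rcases max_choice |x| |y| with h | h <;> rw [h] <;> linarith
  calc _ = ∫⁻ z, ENNReal.ofReal (|z PrimeIndex.first| ^ p) *
        ENNReal.ofReal (succMin 1 L ^ (-(3 / 2 * p))) ∂Q :=
        (lintegral_mul_const' _ _ ENNReal.ofReal_ne_top).symm
    _ ≤ ∫⁻ z, (ENNReal.ofReal (|limitSum (z, L)| ^ p) +
        ENNReal.ofReal (|limitSum (fun k => ε k * z k, L)| ^ p)) ∂Q := lintegral_mono_ae hpt
    _ = ∫⁻ z, ENNReal.ofReal (|limitSum (z, L)| ^ p) ∂Q +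
        ∫⁻ z, ENNReal.ofReal (|limitSum (fun k => ε k * z k, L)| ^ p) ∂Q :=
        lintegral_add_left hmeas _
    _ = _ := by rw [hflip.lintegral_comp hmeas, two_mul]

theorem map_limitSum_symm (hQ : IsSymmetricNoise Q) {μ : Measure UnimodularLattice} [SFinite μ]
    (hμ : ∀ᵐ L ∂μ, IsGeneric L) :
    (Q.prod μ).map limitSum = (Q.prod μ).map fun x => -limitSum x := by
  have hflip : MeasurePreserving
      (Prod.map (fun (z : PrimeIndex → ℝ) k => -1 * z k) (id : UnimodularLattice → _))
      (Q.prod μ) (Q.prod μ) :=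
    (hQ.flip (fun _ => -1) fun _ => Or.inr rfl).prod (MeasurePreserving.id μ)
  calc (Q.prod μ).map limitSum = ((Q.prod μ).map (Prod.map
        (fun (z : PrimeIndex → ℝ) k => -1 * z k) (id : UnimodularLattice → _))).map limitSum := by
        rw [hflip.map_eq]
    _ = (Q.prod μ).map (limitSum ∘ Prod.map (fun (z : PrimeIndex → ℝ) k => -1 * z k) id) :=
        Measure.map_map measurable_limitSum hflip.measurable
    _ = _ := by
        refine Measure.map_congr ?_
        filter_upwards [ae_prod_hasLimit hQ hμ] with ⟨z, L⟩ ⟨hL, hz⟩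
        have h : Tendsto (fun q : ℚ => truncatedSum q (fun k => -1 * z k, L)) atTop
            (𝓝 (-limitSum (z, L))) := by
          refine hz.tendsto_rat.neg.congr fun q => ?_
          rw [truncatedSum_eq_sum hL, truncatedSum_eq_sum hL, ← Finset.sum_neg_distrib]
          exact Finset.sum_congr rfl fun k _ => by ring
        exact h.limUnder_eq

theorem integrable_limitSum_rpow_iff {μ : Measure UnimodularLattice} [SFinite μ] (p : ℝ) :
    Integrable (fun x => |limitSum x| ^ p) (Q.prod μ) ↔
      ∫⁻ L, ∫⁻ z, ENNReal.ofReal (|limitSum (z, L)| ^ p) ∂Q ∂μ ≠ ∞ := by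
  have hm : Measurable fun x => |limitSum x| ^ p := measurable_limitSum.abs.pow_const p
  rw [← lintegral_prod_symm' (fun x => ENNReal.ofReal (|limitSum x| ^ p)) hm.ennreal_ofReal,
    ← lt_top_iff_ne_top, Integrable,
    hasFiniteIntegral_iff_ofReal (Eventually.of_forall fun x => by positivity)]
  exact and_iff_right hm.aestronglyMeasurable

theorem integrable_limitSum_rpow (hQ : IsSymmetricNoise Q) {μ : Measure UnimodularLattice}
    [SFinite μ] (hμ : ∀ᵐ L ∂μ, IsGeneric L) {p : ℝ} (hp : 0 ≤ p)
    (h : ∫⁻ L, ENNReal.ofReal (succMin 1 L ^ (-(3 / 2 * p))) ∂μ ≠ ∞) :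
    Integrable (fun x => |limitSum x| ^ p) (Q.prod μ) := by
  rw [integrable_limitSum_rpow_iff]
  obtain ⟨C, hC, hbound⟩ := exists_lintegral_limitSum_rpow_le hQ hp
  refine ne_top_of_le_ne_top (ENNReal.mul_ne_top hC h) ?_
  rw [← lintegral_const_mul _ (measurable_succMin_rpow _)]
  exact lintegral_mono_ae (hμ.mono hbound)

/-- The conditional lower bound is integrated over lattices; its constant, the moment of a single
weight, is nonzero because that weight is not almost surely zero. -/
theorem not_integrable_limitSum_rpow (hQ : IsSymmetricNoise Q)
    (hne : ¬ ∀ᵐ z ∂Q, z PrimeIndex.first = 0) {μ : Measure UnimodularLattice}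
    [SFinite μ] (hμ : ∀ᵐ L ∂μ, IsGeneric L) {p : ℝ} (hp : 0 < p)
    (h : ∫⁻ L, ENNReal.ofReal (succMin 1 L ^ (-(3 / 2 * p))) ∂μ = ∞) :
    ¬ Integrable (fun x => |limitSum x| ^ p) (Q.prod μ) := by
  rw [integrable_limitSum_rpow_iff, not_not]
  set c : ℝ≥0∞ := ∫⁻ z, ENNReal.ofReal (|z PrimeIndex.first| ^ p) ∂Q with hc
  have hc0 : c ≠ 0 := by
    intro h0
    have hm : Measurable fun z : PrimeIndex → ℝ => ENNReal.ofReal (|z PrimeIndex.first| ^ p) :=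
      ((measurable_pi_apply _).abs.pow_const p).ennreal_ofReal
    rw [hc, lintegral_eq_zero_iff hm] at h0
    refine hne ?_
    filter_upwards [h0] with z hz
    by_contra hz0
    have := Real.rpow_pos_of_pos (abs_pos.2 hz0) p
    exact absurd (ENNReal.ofReal_eq_zero.1 hz) this.not_ge
  have hle : c * ∫⁻ L, ENNReal.ofReal (succMin 1 L ^ (-(3 / 2 * p))) ∂μ ≤
      2 * ∫⁻ L, ∫⁻ z, ENNReal.ofReal (|limitSum (z, L)| ^ p) ∂Q ∂μ := by
    rw [← lintegral_const_mul _ (measurable_succMin_rpow _),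
      ← lintegral_const_mul' _ _ (by simp)]
    exact lintegral_mono_ae (hμ.mono fun L hL => lintegral_first_rpow_mul_le hQ hp.le hL)
  rw [h, ENNReal.mul_top hc0, top_le_iff] at hle
  by_contra hfin
  exact ENNReal.mul_ne_top (by simp) hfin hle

end Noise

end LatticeWeights

/-! ### Transfer to the given weights and density -/

theorem proposition5p1
    -- `μ₂` is the `SL₂(ℝ)`-invariant probability measure on the space of unimodular lattices
    (μ₂ : Measure LatticeWeights.UnimodularLattice) [IsProbabilityMeasure μ₂]
    [SMulInvariantMeasure (Matrix.SpecialLinearGroup (Fin 2) ℝ)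
      LatticeWeights.UnimodularLattice μ₂]
    -- `μ'` is a probability measure with a bounded density `σ` with respect to `μ₂`
    (σ : LatticeWeights.UnimodularLattice → ℝ≥0) (hσ : Measurable σ)
    (hσ_bdd : ∃ C : ℝ≥0, ∀ L, σ L ≤ C)
    (μ' : Measure LatticeWeights.UnimodularLattice) [IsProbabilityMeasure μ']
    (hμ' : μ' = μ₂.withDensity (fun L => (σ L : ℝ≥0∞)))
    -- the weights
    {Ω : Type*} [MeasurableSpace Ω] (P : Measure Ω) [IsProbabilityMeasure P]
    (Z : LatticeWeights.PrimeIndex → Ω → ℝ) (hZ : ∀ k, Measurable (Z k))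
    (hZ_indep : iIndepFun Z P)
    (hZ_ident : ∀ k l, IdentDistrib (Z k) (Z l) P P)
    (hZ_symm : ∀ k, P.map (Z k) = P.map (fun ω => -Z k ω))
    (hZ_supp : ∀ k, ∃ K : Set ℝ, IsCompact K ∧ ∀ᵐ ω ∂P, Z k ω ∈ K)
    (hZ_ne : ∀ k, ¬ (∀ᵐ ω ∂P, Z k ω = 0)) :
    -- `e₁(L)` and `e₂(L)` are well defined for almost every `L`
    (∀ᵐ L ∂μ₂, LatticeWeights.succMin 1 L < LatticeWeights.succMin 2 L ∧
      ∃! v, LatticeWeights.IsMinimalPair L v) ∧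
    ∃ S : Ω × LatticeWeights.UnimodularLattice → ℝ,
      Measurable S ∧
      -- almost sure convergence to `S`
      (∀ᵐ x ∂(P.prod μ'),
        Tendsto (fun A : ℝ => LatticeWeights.modifiedSiegel Z A x) atTop (𝓝 (S x))) ∧
      -- `S` is symmetric, integrable and centred
      (P.prod μ').map S = (P.prod μ').map (fun x => -S x) ∧
      (Integrable S (P.prod μ') ∧ ∫ x, S x ∂(P.prod μ') = 0) ∧
      -- moments of order `1 + κ`
      (∀ κ : ℝ, 0 ≤ κ → κ < 1 / 3 →
        Integrable (fun x => |S x| ^ (1 + κ)) (P.prod μ')) ∧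
      -- no moment of order `4 / 3` if the density is bounded below near the cusp
      ((∃ m : ℝ≥0, 0 < m ∧ ∃ α : ℝ, 0 < α ∧
          ∀ᵐ L ∂μ₂, LatticeWeights.succMin 1 L < α → m ≤ σ L) →
        ¬ Integrable (fun x => |S x| ^ (4 / 3 : ℝ)) (P.prod μ')) ∧
      -- all moments if lattices with short vectors are avoided
      ((∃ α : ℝ, 0 < α ∧ μ' {L | LatticeWeights.succMin 1 L < α} = 0) →
        ∀ p : ℝ, 1 ≤ p → Integrable (fun x => |S x| ^ p) (P.prod μ')) := by
  have hae₂ := LatticeWeights.ae_isGeneric μ₂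
  have hac : μ' ≪ μ₂ := hμ' ▸ withDensity_absolutelyContinuous μ₂ _
  have hae : ∀ᵐ L ∂μ', LatticeWeights.IsGeneric L := hac.ae_le hae₂
  have hZm : Measurable fun ω k => Z k ω := measurable_pi_iff.2 hZ
  set Q : Measure (LatticeWeights.PrimeIndex → ℝ) := P.map fun ω k => Z k ω with hQdef
  have hQprob : IsProbabilityMeasure Q := Measure.isProbabilityMeasure_map hZm.aemeasurable
  have hQ : LatticeWeights.IsSymmetricNoise Q :=
    LatticeWeights.isSymmetricNoise_map hZ hZ_indep hZ_ident hZ_symm hZ_supp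
  have hne : ¬ ∀ᵐ z ∂Q, z LatticeWeights.PrimeIndex.first = 0 := fun h =>
    hZ_ne _ (ae_of_ae_map hZm.aemeasurable h)
  -- The limit lives on sequences of weights; this map pulls its law and integrability back to `Ω ×
  -- 𝒮₂`.
  have hmp : MeasurePreserving
      (Prod.map (fun ω k => Z k ω) (id : LatticeWeights.UnimodularLattice → _))
      (P.prod μ') (Q.prod μ') :=
    (hZm.measurePreserving P).prod (MeasurePreserving.id μ')
  have hSm := LatticeWeights.measurable_limitSum
  have hpow : ∀ p : ℝ, Measurable fun x => |LatticeWeights.limitSum x| ^ p :=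
    fun p => hSm.abs.pow_const p
  have hσm : Measurable fun L => (σ L : ℝ≥0∞) := hσ.coe_nnreal_ennreal
  have hlint : ∀ s : ℝ, ∫⁻ L, ENNReal.ofReal (LatticeWeights.succMin 1 L ^ s) ∂μ' =
      ∫⁻ L, σ L * ENNReal.ofReal (LatticeWeights.succMin 1 L ^ s) ∂μ₂ := fun s => by
    rw [hμ', lintegral_withDensity_eq_lintegral_mul _ hσm
      (LatticeWeights.measurable_succMin_rpow s)]
    rfl
  -- The condition `p < 4/3` is `3p/2 < 2`; the bounded density costs only a constant factor.
  have hmoment : ∀ p : ℝ, 0 ≤ p → p < 4 / 3 →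
      Integrable (fun x => |LatticeWeights.limitSum x| ^ p) (Q.prod μ') := by
    intro p hp hp'
    refine LatticeWeights.integrable_limitSum_rpow hQ hae hp ?_
    obtain ⟨C, hC⟩ := hσ_bdd
    rw [hlint]
    refine ne_top_of_le_ne_top (ENNReal.mul_ne_top (ENNReal.coe_ne_top (r := C))
      (LatticeWeights.lintegral_succMin_rpow_ne_top μ₂ (s := 3 / 2 * p) (by positivity)
        (by linarith))) ?_
    rw [← lintegral_const_mul _ (LatticeWeights.measurable_succMin_rpow _)]
    refine lintegral_mono fun L => ?_
    gcongr
    exact hC L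
  have hsymm : (P.prod μ').map (LatticeWeights.limitSum ∘ Prod.map (fun ω k => Z k ω) id) =
      (P.prod μ').map fun x => -(LatticeWeights.limitSum ∘ Prod.map (fun ω k => Z k ω) id) x := by
    have h := LatticeWeights.map_limitSum_symm hQ hae
    have hneg : Measurable fun x => -LatticeWeights.limitSum x := hSm.neg
    rw [← hmp.map_eq, Measure.map_map hSm hmp.measurable, Measure.map_map hneg hmp.measurable]
      at h
    exact h
  have hinteg : Integrable LatticeWeights.limitSum (Q.prod μ') := by
    have h := hmoment 1 zero_le_one (by norm_num)
    simp only [Real.rpow_one] at h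
    exact (integrable_norm_iff hSm.aestronglyMeasurable).1 h
  refine ⟨hae₂.mono fun L hL => ⟨hL.succMin_lt, hL.existsUnique⟩,
    LatticeWeights.limitSum ∘ Prod.map (fun ω k => Z k ω) id, hSm.comp hmp.measurable, ?_, hsymm,
    ⟨(hmp.integrable_comp hSm.aestronglyMeasurable).2 hinteg, ?_⟩, ?_, ?_, ?_⟩
  · filter_upwards [hmp.quasiMeasurePreserving.ae (LatticeWeights.ae_prod_hasLimit hQ hae)]
      with ⟨ω, L⟩ ⟨hL, hlim⟩
    have hL : LatticeWeights.IsGeneric L := hL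
    refine (LatticeWeights.HasLimit.tendsto hL hlim).congr fun A => ?_
    change LatticeWeights.truncatedSum A (fun k => Z k ω, L) = _
    rw [LatticeWeights.truncatedSum_eq_sum hL, LatticeWeights.modifiedSiegel_eq_sum Z hL]
  · have h1 : ∫ y, y ∂((P.prod μ').map
        (LatticeWeights.limitSum ∘ Prod.map (fun ω k => Z k ω) id)) = _ :=
      integral_map (hSm.comp hmp.measurable).aemeasurable aestronglyMeasurable_id
    have h2 : ∫ y, y ∂((P.prod μ').map fun x =>
        -(LatticeWeights.limitSum ∘ Prod.map (fun ω k => Z k ω) id) x) =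
        ∫ x, -(LatticeWeights.limitSum ∘ Prod.map (fun ω k => Z k ω) id) x ∂(P.prod μ') :=
      integral_map (hSm.comp hmp.measurable).neg.aemeasurable aestronglyMeasurable_id
    rw [← hsymm, h1, integral_neg] at h2
    linarith
  · intro κ hκ hκ'
    exact (hmp.integrable_comp (hpow _).aestronglyMeasurable).2
      (hmoment (1 + κ) (by linarith) (by linarith))
  · rintro ⟨m, hm, α, hα, hσα⟩ hcon
    refine LatticeWeights.not_integrable_limitSum_rpow hQ hne hae (p := 4 / 3) (by norm_num) ?_
      ((hmp.integrable_comp (hpow _).aestronglyMeasurable).1 hcon)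
    have hset : MeasurableSet {L | LatticeWeights.succMin 1 L < α} :=
      measurableSet_lt LatticeWeights.measurable_succMin_one measurable_const
    have htop := LatticeWeights.setLIntegral_succMin_rpow_eq_top μ₂ hα
    -- At `p = 4/3` the exponent is exactly the critical one, and the lower bound `m` on the density
    -- is needed only in the cusp, where the divergence occurs.
    rw [hlint, show (-(3 / 2 * (4 / 3)) : ℝ) = -2 by norm_num, ← top_le_iff]
    calc ∞ = m * ∫⁻ L in {L | LatticeWeights.succMin 1 L < α},
          ENNReal.ofReal (LatticeWeights.succMin 1 L ^ (-2 : ℝ)) ∂μ₂ := by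
          rw [htop, ENNReal.mul_top (by exact_mod_cast hm.ne')]
      _ = ∫⁻ L in {L | LatticeWeights.succMin 1 L < α},
          m * ENNReal.ofReal (LatticeWeights.succMin 1 L ^ (-2 : ℝ)) ∂μ₂ :=
          (lintegral_const_mul _ (LatticeWeights.measurable_succMin_rpow _)).symm
      _ ≤ ∫⁻ L in {L | LatticeWeights.succMin 1 L < α},
          σ L * ENNReal.ofReal (LatticeWeights.succMin 1 L ^ (-2 : ℝ)) ∂μ₂ := by
          refine lintegral_mono_ae ((ae_restrict_iff' hset).2 ?_)
          filter_upwards [hσα] with L hL hLα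
          gcongr
          exact hL hLα
      _ ≤ _ := setLIntegral_le_lintegral _ _
  · rintro ⟨α, hα, hzero⟩ p hp
    refine (hmp.integrable_comp (hpow _).aestronglyMeasurable).2
      (LatticeWeights.integrable_limitSum_rpow hQ hae (by linarith) ?_)
    refine ne_top_of_le_ne_top (b := ENNReal.ofReal (α ^ (-(3 / 2 * p)))) ENNReal.ofReal_ne_top ?_
    have hge : ∀ᵐ L ∂μ', α ≤ LatticeWeights.succMin 1 L := by
      rw [ae_iff]
      simpa only [not_le] using hzero
    calc _ ≤ ∫⁻ _, ENNReal.ofReal (α ^ (-(3 / 2 * p))) ∂μ' := by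
          refine lintegral_mono_ae (hge.mono fun L hL => ENNReal.ofReal_le_ofReal ?_)
          exact Real.rpow_le_rpow_of_nonpos hα hL (by linarith)
      _ = _ := by simp
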